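/- **Traces.** Fix a finite set $\mathit{AP}$ of atomic propositions. A trace is an infinite sequence $\mathit{tr}=P_0m_0P_1m_1\cdots$ with $P_i\subseteq \mathit{AP}$ and $m_i\in\{\mathit{int},\mathit{call},\mathit{ret}\}$; $\mathit{tr}(i)=P_i$, and $\mathit{tr}[i,j]=P_im_i\cdots m_{j-1}P_j$. The abstract summarisation of a finite trace is obtained from its sequence of transition symbols by replacing, from left to right, every call that has a matching return inside the finite trace, together with everything up to and including that return, by one symbol $\mathit{abs}$, and every remaining $\mathit{int}$ by $\mathit{abs}$. Its $\mathit{ret}$-$\mathit{call}$ profile is $(r,c)$ where $r$ and $c$ are the numbers of remaining $\mathit{ret}$ and $\mathit{call}$ symbols. Finite traces are well-aligned if they have the same profile. **Formulae.** Let $N$ be a set of trace variables. Multitrace formulae with well-aligned next operators are $$\psi ::= [\delta]_\pi \mid X \mid \neg\psi \mid \psi\vee\psi \mid \psi\wedge\psi \mid \bigcirc_w^\Delta\psi \mid \bigcirc_d^\Delta\psi \mid \mu X.\psi \mid \nu X.\psi$$ where $\pi\in N$, $\delta$ is a trace formula and the successor assignment $\Delta$ maps every trace variable to a trace formula. The formula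 has basis $\mathit{AP}$ if all trace formulae in its tests and successor assignments are atomic propositions, and unique successor assignment $\Delta$ if all its next operators use $\Delta$. The size $|\psi|$ is the number of distinct (multitrace) subformulae of $\psi$. As usual, formulae are assumed to be in positive form (negation only directly in front of tests $[\delta]_\pi$), strictly guarded (every fixpoint variable is directly preceded by a next operator), and such that every fixpoint variable is bound by only one fixpoint subformula. **Semantics.** For an atomic proposition $p$, $\mathit{succ}_p(\mathit{tr},i)$ is the least $j>i$ with $p\in\mathit{tr}(j)$ if there is one, and $i+1$ otherwise. Let $\Pi$ be a trace assignment with finite domain $D=\{\pi_1,\dots,\pi_n\}\subseteq N$. For $v\in\mathbb N_0^n$, $\mathit{succ}_\Delta(\Pi,v)$ applies $\mathit{succ}_{\Delta(\pi_i)}(\Pi(\pi_i),\cdot)$ to each component $v_i$, and $\mathit{succ}^w_\Delta(\Pi,v)$ equals $v'=\mathit{succ}_\Delta(\Pi,v)$ if the finite traces $\Pi(\pi_i)[v_i,v_i']$ are well-aligned and is undefined otherwise. Formulae denote subsets of $\mathbb N_0^n$: $[p]_{\pi_i}$ holds at $v$ iff $p\in\Pi(\pi_i)(v_i)$; $\bigcirc^\Delta_w\psi$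 holds at $v$ iff $\mathit{succ}^w_\Delta(\Pi,v)$ is defined and satisfies $\psi$; $\bigcirc^\Delta_d\psi$ holds at $v$ iff $\mathit{succ}^w_\Delta(\Pi,v)$ is undefined or satisfies $\psi$; boolean operators and least and greatest fixpoints $\mu,\nu$ are as usual. For closed $\psi$, write $\Pi\models\psi$ if $(0,\dots,0)$ satisfies $\psi$. **Encodings.** Let $\mathcal P_j=(P_j^1,\dots,P_j^n)$, where $P_j^i$ is the set of propositions of $\Pi(\pi_i)$ at the position reached from $0$ by $j$ applications of $\mathit{succ}_{\Delta(\pi_i)}$. Let $l\in\mathbb N_0\cup\{\infty\}$ be the supremum of all $i$ such that $\mathit{succ}^w_\Delta$ can be applied $i$ times to $(0,\dots,0)$, and for $j<l$ let $(r_j,c_j)$ be the common profile of the finite traces skipped in step $j$. For $n\ge 1$ the well-aligned encoding is $$w_\Pi^\Delta=\mathcal P_0\,\mathit{ret}^{r_0}\mathit{call}^{c_0}\,\mathcal P_1\,\mathit{ret}^{r_1}\mathit{call}^{c_1}\cdots\ \text{ if } l=\infty,\qquad w_\Pi^\Delta=\mathcal P_0\,\mathit{ret}^{r_0}\mathit{call}^{c_0}\cdots\mathcal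 P_l\,\top^\omega\ \text{ if } l<\infty.$$ The encodings of the empty trace assignment ($n=0$) are all words in $(()\cdot\{\mathit{ret}\}^*\cdot\{\mathit{call}\}^*)^\omega$. An automaton $\mathcal A$ over the alphabet $(2^{\mathit{AP}})^n\cup\{\mathit{call},\mathit{ret},\top\}$ is aligned $(\Delta,\mathcal T)$-equivalent to $\psi$ (for trace assignments with domain $D$) if for every trace assignment $\Pi$ with domain $D$ and values in $\mathcal T$: if $n\ge 1$, then $\Pi\models\psi$ iff $w_\Pi^\Delta\in\mathcal L(\mathcal A)$; if $n=0$, then $\Pi\models\psi$ iff some encoding of the empty trace assignment is in $\mathcal L(\mathcal A)$. **Automata.** An alternating parity automaton (APA) has a finite set $Q$ of states, a set of initial states, a transition function $\rho$ mapping each state and letter to a positive boolean formula over $Q$, and priorities in $\mathbb N_0$; in each step all copies move to the next letter, and a run tree is accepting if on every path the least priority occurring infinitely often is even. It contains two distinct absorbing states $\mathit{true}$ and $\mathit{false}$ of priorities $0$ and $1$. Its size is the number of states, plus the highest priority, plus the maximum over the letters $\sigma$ of the number of distinct subformulae of the formulae $\rho(q,\sigma)$, $q\in Q$. **Theorem.**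 There is an absolute constant $C$ such that the following holds for all finite sets $\mathit{AP}$ and all $N$. Let $\psi$ be a closed multitrace formula over $N$ and $\mathit{AP}$ with well-aligned next operators, unique successor assignment $\Delta$ and basis $\mathit{AP}$, and let $D\subseteq N$ be a finite set of trace variables that contains all trace variables occurring in $\psi$. Then there is an APA $\mathcal A_\psi$ over $(2^{\mathit{AP}})^D\cup\{\mathit{call},\mathit{ret},\top\}$ of size at most $C\cdot|\psi|$ that is aligned $(\Delta,\mathcal T)$-equivalent to $\psi$ for all sets $\mathcal T$ of traces. -/

import Mathlib

namespace Mumbling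

/-! ### Traces and successor functions -/

/-- Transition symbols of traces. -/
inductive Step where
  | int
  | call
  | ret
  deriving DecidableEq

/-- An infinite trace `P₀ m₀ P₁ m₁ …` over the atomic propositions `AP`. -/
structure Trace (AP : Type*) where
  props : ℕ → Set AP
  step : ℕ → Step

/-- The successor and predecessor types `g` (global), `a` (abstract), `c` (caller). -/
inductive Dir where
  | g
  | a
  | c

/-- The number of positions `k` with `i ≤ k < j` whose transition symbol is `s`. -/
def Trace.countSteps {AP : Type*} (tr : Trace AP) (s : Step) (i j : ℕ) : ℕ :=
  ((Finset.Ico i j).filter (fun k => tr.step k = s)).card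

/-- The candidates for the abstract successor of a call position. -/
def Trace.absCandidates {AP : Type*} (tr : Trace AP) (i : ℕ) : Set ℕ :=
  {j | i < j ∧ tr.countSteps .call i j = tr.countSteps .ret i j}

/-- The candidates for the caller of a position. -/
def Trace.callerCandidates {AP : Type*} (tr : Trace AP) (i : ℕ) : Set ℕ :=
  {j | j < i ∧ tr.step j = .call ∧
    tr.countSteps .call (j + 1) i = tr.countSteps .ret (j + 1) i}

open Classical in
/-- The partial functions `succ_g`, `succ_a` and `succ_c`. -/
noncomputable def Trace.succDir {AP : Type*} (tr : Trace AP) : Dir → ℕ → Option ℕ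
  | .g, i => some (i + 1)
  | .a, i =>
    match tr.step i with
    | .int => some (i + 1)
    | .call => if (tr.absCandidates i).Nonempty then some (sInf (tr.absCandidates i)) else none
    | .ret => none
  | .c, i =>
    if (tr.callerCandidates i).Nonempty then some (sSup (tr.callerCandidates i)) else none

/-! ### Trace formulae -/

/-- Trace formulae; fixpoint variables are named by natural numbers. -/
inductive TraceFormula (AP : Type*) where
  | atom (p : AP)
  | var (Y : ℕ)
  | or (δ₁ δ₂ : TraceFormula AP)
  | neg (δ : TraceFormula AP)
  | next (f : Dir) (δ : TraceFormula AP)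
  | mu (Y : ℕ) (δ : TraceFormula AP)

/-- The free fixpoint variables of a trace formula. -/
def TraceFormula.freeVars {AP : Type*} : TraceFormula AP → Set ℕ
  | .atom _ => ∅
  | .var Y => {Y}
  | .or δ₁ δ₂ => δ₁.freeVars ∪ δ₂.freeVars
  | .neg δ => δ.freeVars
  | .next _ δ => δ.freeVars
  | .mu Y δ => δ.freeVars \ {Y}

/-- The semantics of trace formulae under a fixpoint variable assignment. -/
def TraceFormula.sem {AP : Type*} (tr : Trace AP) : TraceFormula AP → (ℕ → Set ℕ) → Set ℕ
  | .atom p, _ => {i | p ∈ tr.props i}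
  | .var Y, V => V Y
  | .or δ₁ δ₂, V => δ₁.sem tr V ∪ δ₂.sem tr V
  | .neg δ, V => (δ.sem tr V)ᶜ
  | .next f δ, V => {i | ∃ j, tr.succDir f i = some j ∧ j ∈ δ.sem tr V}
  | .mu Y δ, V => ⋂₀ {I | δ.sem tr (Function.update V Y I) ⊆ I}

/-- The positions of `tr` that satisfy `δ` under the empty fixpoint variable assignment. -/
def TraceFormula.positions {AP : Type*} (δ : TraceFormula AP) (tr : Trace AP) : Set ℕ :=
  δ.sem tr (fun _ => ∅)

open Classical in
/-- `succ_δ(tr, i)`: the next position after `i` where `δ` holds, or `i + 1` if there is none. -/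
noncomputable def succTF {AP : Type*} (δ : TraceFormula AP) (tr : Trace AP) (i : ℕ) : ℕ :=
  if {j | i < j ∧ j ∈ δ.positions tr}.Nonempty then sInf {j | i < j ∧ j ∈ δ.positions tr}
  else i + 1

/-! ### Abstract summarisations and well-alignedness -/

/-- Symbols of abstract summarisations. -/
inductive AbsStep where
  | abs
  | call
  | ret
  deriving DecidableEq

/-- For the transition symbols `m` of a finite trace that starts with a call, the abstract
successor of position `0` inside that finite trace: the least `k` with `0 < k ≤ |m|` such that
there are equally many calls and returns before `k`. -/
def finAbsSucc (m : List Step) : Option ℕ :=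
  (List.range' 1 m.length).find?
    (fun k => decide ((m.take k).count .call = (m.take k).count .ret))

theorem finAbsSucc_pos {m : List Step} {k : ℕ} (h : finAbsSucc m = some k) : 0 < k := by
  have hk := List.mem_of_find?_eq_some h
  rw [List.mem_range'_1] at hk
  omega

/-- The abstract summarisation of a finite trace with transition symbols `m` (it does not depend
on the propositional symbols): internal steps become `abs`, and, from left to right, every call
that has an abstract successor inside the finite trace is replaced, together with everything up
to that successor, by a single `abs`. -/
def absSum : List Step → List AbsStep
  | [] => []
  | .int :: m => .abs :: absSum m
  | .ret :: m => .ret :: absSum m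
  | .call :: m =>
    match _h : finAbsSucc (.call :: m) with
    | some k => .abs :: absSum ((Step.call :: m).drop k)
    | none => .call :: absSum m
  termination_by m => m.length
  decreasing_by
    all_goals simp
    have := finAbsSucc_pos _h
    omega

/-- The `ret`-`call` profile `(r, c)` of a finite trace with transition symbols `m`. -/
def profile (m : List Step) : ℕ × ℕ :=
  ((absSum m).count .ret, (absSum m).count .call)

/-- The transition symbols `m_i … m_{j-1}` of the finite trace `tr[i, j]`, for `i ≤ j`. -/
def Trace.steps {AP : Type*} (tr : Trace AP) (i j : ℕ) : List Step :=
  (List.range' i (j - i)).map tr.step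

/-! ### Multitrace formulae -/

/-- Multitrace formulae with well-aligned next operators over the trace variables `N`.
Conjunction, the greatest fixpoint and the dual `nextD` of the well-aligned next operator `nextW`
are constructors, so that positive forms can be expressed. -/
inductive Formula (N AP : Type*) where
  | test (δ : TraceFormula AP) (π : N)
  | var (X : ℕ)
  | neg (ψ : Formula N AP)
  | or (ψ₁ ψ₂ : Formula N AP)
  | and (ψ₁ ψ₂ : Formula N AP)
  | nextW (Δ : N → TraceFormula AP) (ψ : Formula N AP)
  | nextD (Δ : N → TraceFormula AP) (ψ : Formula N AP)
  | mu (X : ℕ) (ψ : Formula N AP)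
  | nu (X : ℕ) (ψ : Formula N AP)

namespace Formula

variable {N AP : Type*}

/-- The set of (multitrace) subformulae, including the formula itself. -/
def subformulae : Formula N AP → Set (Formula N AP)
  | test δ π => {test δ π}
  | var X => {var X}
  | neg ψ => insert (neg ψ) ψ.subformulae
  | or ψ₁ ψ₂ => insert (or ψ₁ ψ₂) (ψ₁.subformulae ∪ ψ₂.subformulae)
  | and ψ₁ ψ₂ => insert (and ψ₁ ψ₂) (ψ₁.subformulae ∪ ψ₂.subformulae)
  | nextW Δ ψ => insert (nextW Δ ψ) ψ.subformulae
  | nextD Δ ψ => insert (nextD Δ ψ) ψ.subformulae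
  | mu X ψ => insert (mu X ψ) ψ.subformulae
  | nu X ψ => insert (nu X ψ) ψ.subformulae

theorem subformulae_finite (ψ : Formula N AP) : ψ.subformulae.Finite := by
  induction ψ <;> simp_all [subformulae]

/-- The size of a formula: the number of its distinct subformulae. -/
noncomputable def size (ψ : Formula N AP) : ℕ := ψ.subformulae.ncard

/-- The free fixpoint variables. -/
def freeVars : Formula N AP → Set ℕ
  | test _ _ => ∅
  | var X => {X}
  | neg ψ => ψ.freeVars
  | or ψ₁ ψ₂ => ψ₁.freeVars ∪ ψ₂.freeVars
  | and ψ₁ ψ₂ => ψ₁.freeVars ∪ ψ₂.freeVars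
  | nextW _ ψ => ψ.freeVars
  | nextD _ ψ => ψ.freeVars
  | mu X ψ => ψ.freeVars \ {X}
  | nu X ψ => ψ.freeVars \ {X}

/-- The trace variables that occur in tests. -/
def traceVars (ψ : Formula N AP) : Set N := {π | ∃ δ, test δ π ∈ ψ.subformulae}

/-- The successor assignments used by the next operators. -/
def assignments (ψ : Formula N AP) : Set (N → TraceFormula AP) :=
  {Δ | ∃ χ, nextW Δ χ ∈ ψ.subformulae ∨ nextD Δ χ ∈ ψ.subformulae}

/-- The base formulae: trace formulae occurring in tests or successor assignments. -/
def base (ψ : Formula N AP) : Set (TraceFormula AP) :=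
  {δ | (∃ π, test δ π ∈ ψ.subformulae) ∨ ∃ Δ ∈ ψ.assignments, ∃ π, Δ π = δ}

/-- All fixpoint variables are bound, in the formula and in its base formulae. -/
def Closed (ψ : Formula N AP) : Prop :=
  ψ.freeVars = ∅ ∧ ∀ δ ∈ ψ.base, δ.freeVars = ∅

/-- The formula has basis `AP`: all its base formulae are atomic propositions. -/
def HasAtomicBasis (ψ : Formula N AP) : Prop := ∀ δ ∈ ψ.base, ∃ p, δ = .atom p

/-- All next operators use the successor assignment `Δ`. -/
def HasUniqueAssignment (ψ : Formula N AP) (Δ : N → TraceFormula AP) : Prop :=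
  ∀ Δ' ∈ ψ.assignments, Δ' = Δ

/-- Positive form: negation only occurs directly in front of tests. -/
def PositiveForm (ψ : Formula N AP) : Prop :=
  ∀ χ, neg χ ∈ ψ.subformulae → ∃ δ π, χ = test δ π

/-- Strictly guarded form: every fixpoint variable is directly preceded by a next operator. -/
def StrictlyGuarded : Formula N AP → Prop
  | test _ _ => True
  | var _ => False
  | neg ψ => ψ.StrictlyGuarded
  | or ψ₁ ψ₂ => ψ₁.StrictlyGuarded ∧ ψ₂.StrictlyGuarded
  | and ψ₁ ψ₂ => ψ₁.StrictlyGuarded ∧ ψ₂.StrictlyGuarded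
  | nextW _ ψ => (∃ X, ψ = var X) ∨ ψ.StrictlyGuarded
  | nextD _ ψ => (∃ X, ψ = var X) ∨ ψ.StrictlyGuarded
  | mu _ ψ => ψ.StrictlyGuarded
  | nu _ ψ => ψ.StrictlyGuarded

/-- The formula `χ` is a fixpoint formula `μ X. ψ` or `ν X. ψ`. -/
def Binds (χ : Formula N AP) (X : ℕ) : Prop := ∃ ψ, χ = mu X ψ ∨ χ = nu X ψ

/-- No fixpoint variable is bound by two different fixpoint subformulae. -/
def UniquelyBound (ψ : Formula N AP) : Prop :=
  ∀ X, ∀ χ₁ ∈ ψ.subformulae, ∀ χ₂ ∈ ψ.subformulae, χ₁.Binds X → χ₂.Binds X → χ₁ = χ₂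

end Formula

/-! ### Semantics of multitrace formulae

A trace assignment with finite domain `D` is a function `tra : D → Trace AP`; vectors of positions
are functions `v : D → ℕ`. -/

section Semantics

variable {N AP : Type*} {D : Finset N}

/-- `succ_Δ(tra, v)`. -/
noncomputable def succAll (Δ : N → TraceFormula AP) (tra : D → Trace AP) (v : D → ℕ) : D → ℕ :=
  fun π => succTF (Δ π) (tra π) (v π)

/-- The profile of the finite trace that `succ_Δ` skips on trace `π` from the vector `v`. -/
noncomputable def skipProfile (Δ : N → TraceFormula AP) (tra : D → Trace AP) (v : D → ℕ) (π : D) :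
    ℕ × ℕ :=
  profile ((tra π).steps (v π) (succAll Δ tra v π))

/-- The finite traces skipped by `succ_Δ` from `v` are well-aligned. -/
def WellAligned (Δ : N → TraceFormula AP) (tra : D → Trace AP) (v : D → ℕ) : Prop :=
  ∀ π π' : D, skipProfile Δ tra v π = skipProfile Δ tra v π'

open Classical in
/-- The partial function `succ_Δ^w(tra, v)`. -/
noncomputable def succW (Δ : N → TraceFormula AP) (tra : D → Trace AP) (v : D → ℕ) :
    Option (D → ℕ) :=
  if WellAligned Δ tra v then some (succAll Δ tra v) else none

/-- The semantics of multitrace formulae under a fixpoint variable assignment `W`. -/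
def Formula.sem (tra : D → Trace AP) : Formula N AP → (ℕ → Set (D → ℕ)) → Set (D → ℕ)
  | .test δ π, _ => {v | ∃ h : π ∈ D, v ⟨π, h⟩ ∈ δ.positions (tra ⟨π, h⟩)}
  | .var X, W => W X
  | .neg ψ, W => (ψ.sem tra W)ᶜ
  | .or ψ₁ ψ₂, W => ψ₁.sem tra W ∪ ψ₂.sem tra W
  | .and ψ₁ ψ₂, W => ψ₁.sem tra W ∩ ψ₂.sem tra W
  | .nextW Δ ψ, W => {v | ∃ v', succW Δ tra v = some v' ∧ v' ∈ ψ.sem tra W}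
  | .nextD Δ ψ, W => {v | ∀ v', succW Δ tra v = some v' → v' ∈ ψ.sem tra W}
  | .mu X ψ, W => ⋂₀ {V | ψ.sem tra (Function.update W X V) ⊆ V}
  | .nu X ψ, W => ⋃₀ {V | V ⊆ ψ.sem tra (Function.update W X V)}

/-- `tra ⊨ ψ`. For a multitrace formula this does not depend on the set of traces quantified over. -/
def Formula.Sat (tra : D → Trace AP) (ψ : Formula N AP) : Prop :=
  (fun _ => 0) ∈ ψ.sem tra (fun _ => ∅)

/-! ### Well-aligned encodings -/

/-- `prog_w(tra, Δ, i)`: the partially defined `i`-fold application of `succ_Δ^w` to `(0, …, 0)`. -/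
noncomputable def progW (Δ : N → TraceFormula AP) (tra : D → Trace AP) : ℕ → Option (D → ℕ)
  | 0 => some (fun _ => 0)
  | i + 1 => (progW Δ tra i).bind (succW Δ tra)

/-- The length of the `Δ`-well-aligned prefix of `tra`. -/
noncomputable def wapref (Δ : N → TraceFormula AP) (tra : D → Trace AP) : ℕ∞ :=
  sSup {l | ∃ i : ℕ, (progW Δ tra i).isSome ∧ l = i}

/-- The letters of encodings: tuples of sets of atomic propositions indexed by `D`, the symbols
`call` and `ret`, and the symbol `⊤`. -/
inductive Letter {N : Type*} (D : Finset N) (AP : Type*) where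
  | props (P : D → Set AP)
  | call
  | ret
  | top

/-- The infinite concatenation `b 0 · b 1 · b 2 ⋯` of nonempty finite words `b j`. (The first
`i + 1` words have at least `i + 1` letters, so the default letter is never used.) -/
def concat (b : ℕ → List (Letter D AP)) (i : ℕ) : Letter D AP :=
  ((List.range (i + 1)).flatMap b).getD i .top

/-- The word `P · {ret}^r · {call}^c` for `rc = (r, c)`. -/
def blockWord (P : D → Set AP) (rc : ℕ × ℕ) : List (Letter D AP) :=
  .props P :: (List.replicate rc.1 .ret ++ List.replicate rc.2 .call)

/-- The vector of positions reached by `j` applications of `succ_Δ` to `(0, …, 0)`. -/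
noncomputable def prog (Δ : N → TraceFormula AP) (tra : D → Trace AP) (j : ℕ) : D → ℕ :=
  (succAll Δ tra)^[j] (fun _ => 0)

/-- The tuple of sets of atomic propositions that hold after `j` applications of `succ_Δ`. -/
noncomputable def labels (Δ : N → TraceFormula AP) (tra : D → Trace AP) (j : ℕ) : D → Set AP :=
  fun π => (tra π).props (prog Δ tra j π)

open Classical in
/-- The well-aligned encoding of a trace assignment `tra` with nonempty domain. The profiles are
read off from the trace `π₁`; for the well-aligned steps all traces yield the same profile. -/
noncomputable def encoding (Δ : N → TraceFormula AP) (tra : D → Trace AP) (π₁ : D) :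
    ℕ → Letter D AP :=
  concat fun j =>
    if (j : ℕ∞) < wapref Δ tra then
      blockWord (labels Δ tra j) (skipProfile Δ tra (prog Δ tra j) π₁)
    else if (j : ℕ∞) = wapref Δ tra then [.props (labels Δ tra j)]
    else [.top]

/-- The encodings of the trace assignment with empty domain: the words in
`(() · {ret}* · {call}*)^ω`. (Used for `D = ∅` only, where `fun _ => ∅` is the empty tuple.) -/
def IsEmptyEncoding (w : ℕ → Letter D AP) : Prop :=
  ∃ rc : ℕ → ℕ × ℕ, w = concat fun j => blockWord (fun _ => ∅) (rc j)

end Semantics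

/-! ### Alternating parity automata -/

/-- Positive boolean formulae (without constants) over `Q`. -/
inductive PosBool (Q : Type*) where
  | atom (q : Q)
  | or (f g : PosBool Q)
  | and (f g : PosBool Q)

/-- The set `S` satisfies a positive boolean formula. -/
def PosBool.Sat {Q : Type*} (S : Set Q) : PosBool Q → Prop
  | .atom q => q ∈ S
  | .or f g => f.Sat S ∨ g.Sat S
  | .and f g => f.Sat S ∧ g.Sat S

/-- The set of subformulae of a positive boolean formula. -/
def PosBool.subformulae {Q : Type*} : PosBool Q → Set (PosBool Q)
  | .atom q => {.atom q}
  | .or f g => insert (.or f g) (f.subformulae ∪ g.subformulae)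
  | .and f g => insert (.and f g) (f.subformulae ∪ g.subformulae)

/-- An alternating parity automaton over the alphabet `A`. In every step all copies move to the
next position of the input. There are distinct states `tt` and `ff`, with priorities `0` and `1`,
that are never left. -/
structure APA (A : Type*) where
  State : Type
  finite : Finite State
  init : Set State
  trans : State → A → PosBool State
  prio : State → ℕ
  tt : State
  ff : State
  tt_ne_ff : tt ≠ ff
  prio_tt : prio tt = 0
  prio_ff : prio ff = 1
  trans_tt : ∀ a, trans tt a = .atom tt
  trans_ff : ∀ a, trans ff a = .atom ff

/-- A tree is a set of finite sequences of natural numbers that contains the root `[]`, is closed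
under parents and left siblings, and in which every node has a child. -/
structure IsTree (T : Set (List ℕ)) : Prop where
  root : [] ∈ T
  parent : ∀ t n, t ++ [n] ∈ T → t ∈ T
  sibling : ∀ t n m, t ++ [n] ∈ T → m < n → t ++ [m] ∈ T
  child : ∀ t ∈ T, ∃ n, t ++ [n] ∈ T

/-- The infinite paths of a tree, starting in the root. -/
def IsPath (T : Set (List ℕ)) (p : ℕ → List ℕ) : Prop :=
  p 0 = [] ∧ ∀ i, p (i + 1) ∈ T ∧ ∃ n, p (i + 1) = p i ++ [n]

namespace APA

variable {A : Type*}

/-- `(T, r)` is a `(q, j)`-run of the automaton over the word `w`: for every node `t` labelled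
`(i, q')` there is a set `{q₀, …, q_{l-1}}` of states satisfying the transition formula of `q'` and
`w i`, and the children of `t` are `t·0, …, t·(l-1)`, labelled `(i+1, q₀), …, (i+1, q_{l-1})`. -/
structure IsRun (𝒜 : APA A) (w : ℕ → A) (q : 𝒜.State) (j : ℕ) (T : Set (List ℕ))
    (r : List ℕ → ℕ × 𝒜.State) : Prop where
  tree : IsTree T
  root : r [] = (j, q)
  step : ∀ t ∈ T, ∃ S : List 𝒜.State,
    (𝒜.trans (r t).2 (w (r t).1)).Sat {s | s ∈ S} ∧
    (∀ n, t ++ [n] ∈ T ↔ n < S.length) ∧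
    ∀ (n : ℕ) (h : n < S.length), r (t ++ [n]) = ((r t).1 + 1, S[n])

/-- On every path the lowest priority occurring infinitely often is even. -/
def IsAccepting (𝒜 : APA A) (T : Set (List ℕ)) (r : List ℕ → ℕ × 𝒜.State) : Prop :=
  ∀ p, IsPath T p →
    ∃ k, IsLeast {k | ∃ᶠ i in Filter.atTop, 𝒜.prio (r (p i)).2 = k} k ∧ Even k

/-- The language of the automaton. -/
def language (𝒜 : APA A) : Set (ℕ → A) :=
  {w | ∃ q ∈ 𝒜.init, ∃ T r, 𝒜.IsRun w q 0 T r ∧ 𝒜.IsAccepting T r}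

/-- The distinct subformulae of the transition formulae for the letter `a`. -/
def transSubformulae (𝒜 : APA A) (a : A) : Set (PosBool 𝒜.State) :=
  ⋃ q, (𝒜.trans q a).subformulae

/-- The size of an automaton: the number of its states, plus its highest priority, plus the size of
its transition function, i.e. the number of distinct subformulae of the transition formulae (the
maximum of this number over the letters). -/
noncomputable def size (𝒜 : APA A) : ℕ∞ :=
  ENat.card 𝒜.State + (⨆ q, (𝒜.prio q : ℕ∞)) + ⨆ a, (𝒜.transSubformulae a).encard

end APA

/-- Aligned `(Δ, 𝒯)`-equivalence of an automaton and a multitrace formula, with respect to trace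
assignments with domain `D`. -/
def AlignedEquivalent {N AP : Type*} (D : Finset N) (Δ : N → TraceFormula AP)
    (𝒯 : Set (Trace AP)) (ψ : Formula N AP) (𝒜 : APA (Letter D AP)) : Prop :=
  ∀ tra : D → Trace AP, (∀ π, tra π ∈ 𝒯) →
    (∀ π₁ : D, ψ.Sat tra ↔ encoding Δ tra π₁ ∈ 𝒜.language) ∧
    (D = ∅ → (ψ.Sat tra ↔ ∃ w, IsEmptyEncoding w ∧ w ∈ 𝒜.language))

end Mumbling

namespace Mumbling

universe u

/-! ### Strategies -/

/-! The automaton plays the evaluation game of `ψ`. An obligation is a pair of a formula and a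
vector of positions. It is discharged by evaluating the boolean part of the formula on the current
tuple, unfolding fixpoints once, and passing on obligations for the next vector. Strict guardedness
makes this local evaluation well founded: between two unfoldings of a variable a next operator is
crossed. A state therefore only has to remember the subformula to be verified at the next tuple,
together with one bit for the kind of next operator that produced it. This bit decides what `⊤`
means. The symbols `call` and `ret` are skipped: their positions and numbers carry no information
that `ψ` can test, since well-alignment of a step is already visible in whether a further tuple
follows. A variable gets a smaller priority the further out its binder lies, odd for `mu` and even
for `nu`.

Correctness does not use determinacy of parity games. By induction on the formula,
`WellFormed.locallyHolds` turns truth into a strategy graph all of whose infinite paths satisfy the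
parity condition. Least fixpoints are handled by continuing exits (`Strategy.continue`), which
relies on the induction principle of the least pre-fixpoint. Greatest fixpoints are handled by
looping exits back (`Strategy.loop`) at the dominating even priority. If `ψ` fails, the dual formula
holds (`WellFormed.sem_dual`), and the same result gives a strategy for it with all priorities
raised by one.

`forces_autTrans` and `parityGood_play` transfer both kinds of strategies to the automaton along any
word that encodes the trace assignment. A strategy for `ψ` yields an accepting run. A strategy for
the dual selects in every accepting run a path whose priorities satisfy the parity condition both as
they are and raised by one, which `ParityGood.not_succ` excludes.

The size is linear because transition formulae are images of subformulae of `ψ`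
(`subformulae_evalFormula`), up to atoms, and unfolding a variable leads back to a subformula
(`unfold_mem_or`). -/

/-- The least number that occurs infinitely often in `p` exists and is even. -/
def ParityGood (p : ℕ → ℕ) : Prop :=
  ∃ k, IsLeast {k | ∃ᶠ i in Filter.atTop, p i = k} k ∧ Even k

theorem ParityGood.congr {p q : ℕ → ℕ} (hp : ParityGood p)
    (h : ∀ k, (∃ᶠ i in Filter.atTop, p i = k) ↔ ∃ᶠ i in Filter.atTop, q i = k) :
    ParityGood q := by
  unfold ParityGood at *
  simpa only [h] using hp

theorem frequently_atTop_add {P : ℕ → Prop} (n : ℕ) :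
    (∃ᶠ i in Filter.atTop, P (n + i)) ↔ ∃ᶠ i in Filter.atTop, P i := by
  simp only [Filter.frequently_atTop]
  constructor
  · intro h a
    obtain ⟨b, hb, hP⟩ := h a
    exact ⟨n + b, by omega, hP⟩
  · intro h a
    obtain ⟨b, hb, hP⟩ := h (n + a)
    exact ⟨b - n, by omega, by rwa [Nat.add_sub_cancel' (by omega)]⟩

theorem ParityGood.of_tail {p : ℕ → ℕ} (n : ℕ) (h : ParityGood fun i => p (n + i)) :
    ParityGood p :=
  h.congr fun k => frequently_atTop_add (P := fun i => p i = k) n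

/-- Two sequences that differ by one cannot both satisfy the parity condition. -/
theorem ParityGood.not_succ {p : ℕ → ℕ} (h : ParityGood p) : ¬ ParityGood fun i => p i + 1 := by
  rintro ⟨k', ⟨hk', hmin'⟩, he'⟩
  obtain ⟨k, ⟨hk, hmin⟩, he⟩ := h
  have h1 : k' ≤ k + 1 := hmin' (hk.mono fun i hi => by simp only [hi])
  -- An occurrence of `k'` as `p i + 1` shows that it is positive, so the truncated `k' - 1` below
  -- is genuine and `k' = k + 1` follows.
  obtain ⟨i, hi⟩ := hk'.exists
  simp only at hi
  have h2 : k ≤ k' - 1 := hmin (hk'.mono fun i hi => by simp only at hi; omega)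
  rw [Nat.even_iff] at he he'
  omega

variable {L : Type u}

/-- A strategy graph for the obligation `x`. Every node is labelled by an obligation, and either it
is an exit (a dead end with label in `R`), or its label lies in `A` and is discharged by the labels
of its successors. All infinite paths satisfy the parity condition. -/
structure Strategy (step : L → Set L → Prop) (pr : L → ℕ) (A R : Set L) (x : L) where
  Node : Type u
  label : Node → L
  edge : Node → Node → Prop
  root : Node
  label_root : label root = x
  valid : ∀ s, (label s ∈ R ∧ ∀ t, ¬ edge s t) ∨
    (label s ∈ A ∧ step (label s) (label '' {t | edge s t}))
  good : ∀ p : ℕ → Node, (∀ i, edge (p i) (p (i + 1))) → ParityGood fun i => pr (label (p i))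

variable {step : L → Set L → Prop} {pr : L → ℕ} {A A' R R' : Set L}

theorem Strategy.mono {x : L} (G : Strategy step pr A R x) (hA : A ⊆ A') (hR : R ⊆ R') :
    Nonempty (Strategy step pr A' R' x) :=
  ⟨{ G with valid := fun s => (G.valid s).imp (And.imp_left (@hR _)) (And.imp_left (@hA _)) }⟩

theorem Strategy.of_exit {x : L} (hx : x ∈ R) : Nonempty (Strategy step pr A R x) :=
  ⟨{ Node := PUnit
     label := fun _ => x
     edge := fun _ _ => False
     root := ⟨⟩
     label_root := rfl
     valid := fun _ => .inl ⟨hx, fun _ h => h⟩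
     good := fun _ h => (h 0).elim }⟩

/-- The edges of the graph that is glued together from a family of strategies: the exits in `Z i`
are connected to the roots with index in `C`. -/
inductive GlueEdge {ι : Type u} {x : ι → L} {Z : ι → Set L} (C : Set ι)
    (H : ∀ i, Strategy step pr A' (R ∪ Z i) (x i)) :
    (Σ i, (H i).Node) → (Σ i, (H i).Node) → Prop
  | inner (i : ι) (s t : (H i).Node) : (H i).edge s t → GlueEdge C H ⟨i, s⟩ ⟨i, t⟩
  | cross (i j : ι) (s : (H i).Node) : (H i).label s ∈ Z i → (∀ t, ¬ (H i).edge s t) → j ∈ C →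
      GlueEdge C H ⟨i, s⟩ ⟨j, (H j).root⟩

theorem GlueEdge.inner_or_cross {ι : Type u} {x : ι → L} {Z : ι → Set L} {C : Set ι}
    {H : ∀ i, Strategy step pr A' (R ∪ Z i) (x i)} {i : ι} {s : (H i).Node}
    {b : Σ i, (H i).Node} (h : GlueEdge C H ⟨i, s⟩ b) :
    (∃ t, b = ⟨i, t⟩ ∧ (H i).edge s t) ∨
      ((H i).label s ∈ Z i ∧ (∀ t, ¬ (H i).edge s t) ∧ b.1 ∈ C) := by
  cases h with
  | inner _ _ t h => exact .inl ⟨t, rfl, h⟩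
  | cross _ j _ h1 h2 h3 => exact .inr ⟨h1, h2, h3⟩

/-- A path that crosses between members of the family only finitely often eventually stays in one of
them and inherits its parity condition; `hinf` is what remains to be checked for all other paths.
Both ways of eliminating exits, continuing and looping, are instances. -/
theorem Strategy.glue (hstep : ∀ x O O', O ⊆ O' → step x O → step x O') (hA : A' ⊆ A)
    {ι : Type u} {x : ι → L} (Z : ι → Set L) (C : Set ι)
    (H : ∀ i, Strategy step pr A' (R ∪ Z i) (x i))
    (hZ : ∀ i, ∀ z ∈ Z i, z ∈ A ∧ step z (x '' C))
    (hinf : ∀ (i : ℕ → ι) (l : ℕ → L), (∀ n, l n ∈ A' ∨ l n ∈ Z (i n)) →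
      (∀ n, i (n + 1) = i n ∨ (l n ∈ Z (i n) ∧ i (n + 1) ∈ C)) →
      (∃ᶠ n in Filter.atTop, l n ∈ Z (i n) ∧ i (n + 1) ∈ C) → ParityGood fun n => pr (l n))
    (i₀ : ι) : Nonempty (Strategy step pr A R (x i₀)) := by
  refine ⟨{ Node := Σ i, (H i).Node
            label := fun s => (H s.1).label s.2
            edge := GlueEdge C H
            root := ⟨i₀, (H i₀).root⟩
            label_root := (H i₀).label_root
            valid := ?_
            good := ?_ }⟩
  · rintro ⟨i, s⟩
    by_cases hz : (H i).label s ∈ Z i ∧ ∀ t, ¬ (H i).edge s t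
    · obtain ⟨hA, hs⟩ := hZ i _ hz.1
      refine .inr ⟨hA, hstep _ _ _ ?_ hs⟩
      rintro _ ⟨j, hj, rfl⟩
      exact ⟨⟨j, (H j).root⟩, .cross i j s hz.1 hz.2 hj, (H j).label_root⟩
    · rcases (H i).valid s with ⟨h1, h2⟩ | ⟨h1, h2⟩
      · refine .inl ⟨h1.resolve_right fun h => hz ⟨h, h2⟩, fun t ht => ?_⟩
        rcases ht.inner_or_cross with ⟨t', -, h⟩ | h
        · exact h2 _ h
        · exact hz ⟨h.1, h.2.1⟩
      · refine .inr ⟨hA h1, hstep _ _ _ ?_ h2⟩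
        rintro _ ⟨t, ht, rfl⟩
        exact ⟨⟨i, t⟩, .inner i s t ht, rfl⟩
  · intro p hp
    have hcase : ∀ n, (∃ t, p (n + 1) = ⟨(p n).1, t⟩ ∧ (H (p n).1).edge (p n).2 t) ∨
        ((H (p n).1).label (p n).2 ∈ Z (p n).1 ∧ (∀ t, ¬ (H (p n).1).edge (p n).2 t) ∧
          (p (n + 1)).1 ∈ C) := fun n => (hp n).inner_or_cross
    by_cases hfr : ∃ᶠ n in Filter.atTop,
        (H (p n).1).label (p n).2 ∈ Z (p n).1 ∧ (p (n + 1)).1 ∈ C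
    · refine hinf (fun n => (p n).1) (fun n => (H (p n).1).label (p n).2) ?_ ?_ hfr
      · intro n
        rcases hcase n with ⟨t, -, ht⟩ | h
        · rcases (H (p n).1).valid (p n).2 with h | h
          · exact absurd ht (h.2 _)
          · exact .inl h.1
        · exact .inr h.1
      · intro n
        rcases hcase n with ⟨t, ht, -⟩ | h
        · exact .inl (by simp only [ht])
        · exact .inr ⟨h.1, h.2.2⟩
    -- From `n₀` on no crossing occurs, so the tail is a path `q` inside a single `H i`.
    · rw [Filter.not_frequently, Filter.eventually_atTop] at hfr
      obtain ⟨n₀, hn₀⟩ := hfr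
      obtain ⟨i, s, hs⟩ : ∃ i s, p n₀ = ⟨i, s⟩ := ⟨_, _, rfl⟩
      have hinner : ∀ n, n₀ ≤ n → ∀ i s, p n = ⟨i, s⟩ → ∃ t, p (n + 1) = ⟨i, t⟩ ∧
          (H i).edge s t := by
        intro n hn i s hs
        have h := hcase n
        rw [hs] at h
        rcases h with h | h
        · exact h
        · exact absurd ⟨by rw [hs]; exact h.1, h.2.2⟩ (hn₀ n hn)
      have hall : ∀ n, ∃ t, p (n₀ + n) = ⟨i, t⟩ := by
        intro n
        induction n with
        | zero => exact ⟨s, hs⟩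
        | succ n ih =>
          obtain ⟨t, ht⟩ := ih
          obtain ⟨t', ht', -⟩ := hinner _ (Nat.le_add_right _ _) _ _ ht
          exact ⟨t', ht'⟩
      choose q hq using hall
      have hg := (H i).good q fun n => by
        obtain ⟨t', ht', he⟩ := hinner _ (Nat.le_add_right _ _) _ _ (hq n)
        have := (hq (n + 1)).symm.trans ht'
        rw [Sigma.mk.injEq] at this
        rwa [eq_of_heq this.2]
      refine ParityGood.of_tail n₀ ?_
      have heq : ∀ n, (H (p (n₀ + n)).1).label (p (n₀ + n)).2 = (H i).label (q n) := fun n => by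
        rw [hq n]
      simpa only [heq] using hg

/-- Exits in `Z` can be continued by strategies that avoid `Z`. -/
theorem Strategy.continue (hstep : ∀ x O O', O ⊆ O' → step x O → step x O') (hA : A' ⊆ A)
    {Z : Set L} {x : L} (G : Strategy step pr A' (R ∪ Z) x)
    (hZ : ∀ z ∈ Z, z ∈ A ∧ step z {y | Nonempty (Strategy step pr A R y)}) :
    Nonempty (Strategy step pr A R x) := by
  classical
  let ι := Option {y // Nonempty (Strategy step pr A R y)}
  let Z' : ι → Set L := fun i => i.elim Z fun _ => ∅
  let x' : ι → L := fun i => i.elim x fun y => y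
  have H : ∀ i, Nonempty (Strategy step pr A (R ∪ Z' i) (x' i)) := by
    rintro (_ | ⟨y, ⟨H⟩⟩)
    · exact G.mono hA subset_rfl
    · exact H.mono subset_rfl Set.subset_union_left
  -- The index `none` stands for `G`, whose exits in `Z` are reconnected; the indices `some y` are
  -- the continuations, which have no such exits.
  refine Strategy.glue hstep subset_rfl Z' (Set.range some) (fun i => (H i).some) ?_ ?_ none
  · rintro (_ | y) z hz
    · refine ⟨(hZ z hz).1, hstep _ _ _ ?_ (hZ z hz).2⟩
      intro y hy
      exact ⟨some ⟨y, hy⟩, ⟨_, rfl⟩, rfl⟩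
    · exact hz.elim
  -- After one crossing the index remains of the form `some y`, where `Z'` is empty, so infinitely
  -- many crossings are impossible.
  · intro i l _ h2 h3
    exfalso
    obtain ⟨n, hn⟩ := h3.exists
    have hsome : ∀ m, i (n + 1 + m) ∈ Set.range some := by
      intro m
      induction m with
      | zero => exact hn.2
      | succ m ih =>
        rcases h2 (n + 1 + m) with h | h
        · rw [← add_assoc, h]
          exact ih
        · exact h.2
    obtain ⟨m, hm, hZm, -⟩ := (Filter.frequently_atTop.1 h3) (n + 1)
    obtain ⟨y, hy⟩ := hsome (m - (n + 1))
    rw [Nat.add_sub_cancel' hm] at hy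
    rw [← hy] at hZm
    exact hZm

/-- Exits in `Z` whose priority is even and minimal can be looped back. -/
theorem Strategy.loop (hstep : ∀ x O O', O ⊆ O' → step x O → step x O') (hA : A' ⊆ A)
    {Z : Set L} {x : L} (G : Strategy step pr A' (R ∪ Z) x)
    (hZ : ∀ z ∈ Z, z ∈ A ∧ step z {y | Nonempty (Strategy step pr A' (R ∪ Z) y)})
    {k : ℕ} (hk : Even k) (hkZ : ∀ z ∈ Z, pr z = k) (hkA : ∀ a ∈ A', k ≤ pr a) :
    Nonempty (Strategy step pr A R x) := by
  refine Strategy.glue (ι := {y // Nonempty (Strategy step pr A' (R ∪ Z) y)}) (x := Subtype.val)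
    hstep hA (fun _ => Z) Set.univ (fun y => y.2.some) ?_ ?_ ⟨x, ⟨G⟩⟩
  · intro _ z hz
    refine ⟨(hZ z hz).1, hstep _ _ _ ?_ (hZ z hz).2⟩
    intro y hy
    exact ⟨⟨y, hy⟩, trivial, rfl⟩
  · intro i l h1 _ h3
    -- Each crossing visits an obligation of priority `k`, and no obligation on the path has a
    -- smaller priority.
    refine ⟨k, ⟨h3.mono fun n hn => hkZ _ hn.1, ?_⟩, hk⟩
    intro k' hk'
    obtain ⟨n, hn⟩ := Filter.Frequently.exists hk'
    rw [← hn]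
    rcases h1 n with h | h
    · exact hkA _ h
    · exact (hkZ _ h).ge

/-- An obligation that is discharged by obligations with strategies has a strategy. -/
theorem Strategy.of_step (hstep : ∀ x O O', O ⊆ O' → step x O → step x O') {x : L} (hx : x ∈ A)
    (h : step x {y | Nonempty (Strategy step pr A R y)}) : Nonempty (Strategy step pr A R x) := by
  -- The one-node strategy treats `x` itself as an exit, which is then continued.
  obtain ⟨G⟩ := Strategy.of_exit (step := step) (pr := pr) (A := A) (R := R ∪ {x}) (x := x)
    (.inr rfl)
  refine G.continue hstep subset_rfl ?_
  rintro z rfl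
  exact ⟨hx, h⟩

end Mumbling
namespace Mumbling

/-! ### Obligations of multitrace formulae -/

section Obligations

universe u v
variable {N : Type u} {AP : Type v} {D : Finset N}

namespace Formula

/-- The bound fixpoint variables of a formula in positive form. -/
def boundVars : Formula N AP → Set ℕ
  | test _ _ => ∅
  | var _ => ∅
  | neg _ => ∅
  | or ψ₁ ψ₂ => ψ₁.boundVars ∪ ψ₂.boundVars
  | and ψ₁ ψ₂ => ψ₁.boundVars ∪ ψ₂.boundVars
  | nextW _ ψ => ψ.boundVars
  | nextD _ ψ => ψ.boundVars
  | mu X ψ => insert X ψ.boundVars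
  | nu X ψ => insert X ψ.boundVars

/-- Fixpoint variables are replaced by the bodies `B` of their binders. -/
def unfold (B : ℕ → Formula N AP) : Formula N AP → Formula N AP
  | var X => B X
  | ψ => ψ

/-- The priority of an obligation, where `f` assigns priorities to fixpoint variables. -/
def prio (f : ℕ → ℕ) (M : ℕ) : Formula N AP → ℕ
  | var X => f X
  | _ => M

/-- The formula is strictly guarded, negations only occur in front of formulae whose semantics does
not depend on the fixpoint variables, `B` yields the bodies of all binders, and `f` yields the right
priorities for all bound variables. -/
def WellFormed (tra : D → Trace AP) (B : ℕ → Formula N AP) (f : ℕ → ℕ) (M : ℕ) :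
    Formula N AP → Prop
  | test _ _ => True
  | var _ => False
  | neg ψ => ∀ W W', ψ.sem tra W = ψ.sem tra W'
  | or ψ₁ ψ₂ => ψ₁.WellFormed tra B f M ∧ ψ₂.WellFormed tra B f M
  | and ψ₁ ψ₂ => ψ₁.WellFormed tra B f M ∧ ψ₂.WellFormed tra B f M
  | nextW _ ψ => (∃ X, ψ = var X) ∨ ψ.WellFormed tra B f M
  | nextD _ ψ => (∃ X, ψ = var X) ∨ ψ.WellFormed tra B f M
  | mu X ψ => B X = ψ ∧ Odd (f X) ∧ f X ≤ M ∧ (∀ Y ∈ ψ.boundVars, f X ≤ f Y) ∧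
      ψ.WellFormed tra B f M
  | nu X ψ => B X = ψ ∧ Even (f X) ∧ f X ≤ M ∧ (∀ Y ∈ ψ.boundVars, f X ≤ f Y) ∧
      ψ.WellFormed tra B f M

/-- The formula holds at `v` provided that all obligations in `O` hold, where fixpoints are unfolded
once. -/
def LocallyHolds (tra : D → Trace AP) (O : Set (Formula N AP × (D → ℕ))) :
    Formula N AP → (D → ℕ) → Prop
  | test δ π, v => v ∈ (test δ π).sem tra fun _ => ∅
  | var _, _ => False
  | neg ψ, v => v ∈ (neg ψ).sem tra fun _ => ∅
  | or ψ₁ ψ₂, v => ψ₁.LocallyHolds tra O v ∨ ψ₂.LocallyHolds tra O v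
  | and ψ₁ ψ₂, v => ψ₁.LocallyHolds tra O v ∧ ψ₂.LocallyHolds tra O v
  | nextW Δ ψ, v => ∃ v', succW Δ tra v = some v' ∧ (ψ, v') ∈ O
  | nextD Δ ψ, v => ∀ v', succW Δ tra v = some v' → (ψ, v') ∈ O
  | mu _ ψ, v => ψ.LocallyHolds tra O v
  | nu _ ψ, v => ψ.LocallyHolds tra O v

theorem LocallyHolds.mono {tra : D → Trace AP} {O O' : Set (Formula N AP × (D → ℕ))} (hO : O ⊆ O')
    {ψ : Formula N AP} {v : D → ℕ} (h : ψ.LocallyHolds tra O v) : ψ.LocallyHolds tra O' v := by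
  induction ψ with
  | test | var | neg => exact h
  | or _ _ ih₁ ih₂ => exact h.imp ih₁ ih₂
  | and _ _ ih₁ ih₂ => exact h.imp ih₁ ih₂
  | nextW _ _ _ => exact h.imp fun _ h => ⟨h.1, hO h.2⟩
  | nextD _ _ _ => exact fun v' hv' => hO (h v' hv')
  | mu _ _ ih | nu _ _ ih => exact ih h

/-- The discharge relation on obligations. -/
def obligationStep (tra : D → Trace AP) (B : ℕ → Formula N AP) (x : Formula N AP × (D → ℕ))
    (O : Set (Formula N AP × (D → ℕ))) : Prop :=
  (x.1.unfold B).LocallyHolds tra O x.2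

theorem obligationStep_mono (tra : D → Trace AP) (B : ℕ → Formula N AP) :
    ∀ x O O', O ⊆ O' → obligationStep tra B x O → obligationStep tra B x O' :=
  fun _ _ _ hO h => h.mono hO

/-- Obligations in which only bound variables of `ψ` have to be unfolded. -/
def inner (ψ : Formula N AP) : Set (Formula N AP × (D → ℕ)) :=
  {x | ∀ Y, x.1 = var Y → Y ∈ ψ.boundVars}

/-- Obligations for free variables of `ψ` that hold under `W`. -/
def exits (ψ : Formula N AP) (W : ℕ → Set (D → ℕ)) : Set (Formula N AP × (D → ℕ)) :=
  {x | ∃ Y ∈ ψ.freeVars, x.1 = var Y ∧ x.2 ∈ W Y}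

/-- The obligations that can be discharged by a strategy. -/
def Won (tra : D → Trace AP) (B : ℕ → Formula N AP) (f : ℕ → ℕ) (M : ℕ)
    (A R : Set (Formula N AP × (D → ℕ))) : Set (Formula N AP × (D → ℕ)) :=
  {y | Nonempty (Strategy (obligationStep tra B) (fun x => x.1.prio f M) A R y)}

variable {tra : D → Trace AP} {B : ℕ → Formula N AP} {f : ℕ → ℕ} {M : ℕ}

theorem Won.mono {A A' R R' : Set (Formula N AP × (D → ℕ))} (hA : A ⊆ A') (hR : R ⊆ R') :
    Won tra B f M A R ⊆ Won tra B f M A' R' :=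
  fun _ ⟨G⟩ => G.mono hA hR

theorem WellFormed.ne_var {ψ : Formula N AP} (h : ψ.WellFormed tra B f M) (X : ℕ) :
    ψ ≠ var X := by
  rintro rfl
  exact h

theorem unfold_of_ne_var {ψ : Formula N AP} (h : ∀ X, ψ ≠ var X) : ψ.unfold B = ψ := by
  cases ψ <;> first | rfl | exact absurd rfl (h _)

/-- A variable directly below a next operator is an exit and won at once, because its assigned set
contains the vector. Any other operand is discharged without unfolding. -/
theorem mem_won_of_next {ψ : Formula N AP} {W : ℕ → Set (D → ℕ)} {v : D → ℕ}
    (h : (∃ X, ψ = var X) ∨ ψ.WellFormed tra B f M) (hv : v ∈ ψ.sem tra W)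
    (ih : ψ.WellFormed tra B f M →
      ψ.LocallyHolds tra (Won tra B f M ψ.inner (ψ.exits W)) v) :
    (ψ, v) ∈ Won tra B f M ψ.inner (ψ.exits W) := by
  rcases h with ⟨X, rfl⟩ | h
  · exact Strategy.of_exit ⟨X, rfl, rfl, hv⟩
  · refine Strategy.of_step (obligationStep_mono tra B)
      (fun Y hY => absurd hY (h.ne_var Y)) ?_
    rw [obligationStep, unfold_of_ne_var h.ne_var]
    exact ih h

theorem exits_update {ψ : Formula N AP} {W : ℕ → Set (D → ℕ)} {X : ℕ} {V : Set (D → ℕ)}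
    {R : Set (Formula N AP × (D → ℕ))}
    (hR : {x | ∃ Y ∈ ψ.freeVars \ {X}, x.1 = var Y ∧ x.2 ∈ W Y} ⊆ R) :
    ψ.exits (Function.update W X V) ⊆ R ∪ {z | z.1 = var X ∧ z.2 ∈ V} := by
  rintro ⟨χ, u⟩ ⟨Y, hY, h, hu⟩
  by_cases hYX : Y = X
  · subst hYX
    rw [Function.update_self] at hu
    exact .inr ⟨h, hu⟩
  · rw [Function.update_of_ne hYX] at hu
    exact .inl (hR ⟨Y, ⟨hY, hYX⟩, h, hu⟩)

/-- A formula that holds at `v` is locally justified by obligations that can be won. -/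
theorem WellFormed.locallyHolds {ψ : Formula N AP} (h : ψ.WellFormed tra B f M)
    {W : ℕ → Set (D → ℕ)} {v : D → ℕ} (hv : v ∈ ψ.sem tra W) :
    ψ.LocallyHolds tra (Won tra B f M ψ.inner (ψ.exits W)) v := by
  have hmono : ∀ {ψ₁ ψ₂ : Formula N AP}, ψ₁.boundVars ⊆ ψ₂.boundVars →
      ψ₁.freeVars ⊆ ψ₂.freeVars → ∀ W : ℕ → Set (D → ℕ), Won tra B f M ψ₁.inner (ψ₁.exits W) ⊆
        Won tra B f M ψ₂.inner (ψ₂.exits W) := by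
    intro ψ₁ ψ₂ hb hf W
    exact Won.mono (fun x hx Y hY => hb (hx Y hY))
      (fun x ⟨Y, hY, h⟩ => ⟨Y, hf hY, h⟩)
  induction ψ generalizing W v with
  | test δ π => exact hv
  | var => exact h.elim
  | neg ψ =>
    intro hn
    rw [h _ W] at hn
    exact hv hn
  | or ψ₁ ψ₂ ih₁ ih₂ =>
    exact hv.imp
      (fun hv => (ih₁ h.1 hv).mono (hmono Set.subset_union_left Set.subset_union_left W))
      (fun hv => (ih₂ h.2 hv).mono (hmono Set.subset_union_right Set.subset_union_right W))
  | and ψ₁ ψ₂ ih₁ ih₂ =>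
    exact hv.imp
      (fun hv => (ih₁ h.1 hv).mono (hmono Set.subset_union_left Set.subset_union_left W))
      (fun hv => (ih₂ h.2 hv).mono (hmono Set.subset_union_right Set.subset_union_right W))
  | nextW Δ ψ ih =>
    obtain ⟨v', hs, hv'⟩ := hv
    exact ⟨v', hs, mem_won_of_next h hv' fun h => ih h hv'⟩
  | nextD Δ ψ ih =>
    intro v' hs
    exact mem_won_of_next h (hv v' hs) fun h => ih h (hv v' hs)
  | mu X ψ ih =>
    obtain ⟨hB, -, -, -, hwf⟩ := h
    -- The semantics of `mu` lies in every pre-fixpoint, so it suffices that the set of locally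
    -- justified vectors is one. This fixpoint induction replaces a ranking by ordinals.
    refine hv {u | (mu X ψ).LocallyHolds tra
      (Won tra B f M (mu X ψ).inner ((mu X ψ).exits W)) u} ?_
    intro u hu
    refine (ih hwf hu).mono ?_
    have hA : (ψ.inner : Set (Formula N AP × (D → ℕ))) ⊆ (mu X ψ).inner :=
      fun x hx Y hY => Set.mem_insert_of_mem _ (hx Y hY)
    refine (Won.mono subset_rfl (exits_update (R := (mu X ψ).exits W) subset_rfl)).trans ?_
    rintro x ⟨G⟩
    -- An exit for `X` unfolds to the body, which by the choice of the pre-fixpoint is already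
    -- justified at that vector.
    refine G.continue (obligationStep_mono tra B) hA ?_
    rintro ⟨_, u'⟩ ⟨rfl, hu'⟩
    refine ⟨fun Y hY => ?_, ?_⟩
    · cases hY
      exact Set.mem_insert _ _
    · simp only [obligationStep, unfold, hB]
      exact hu'
  | nu X ψ ih =>
    obtain ⟨hB, he, hM, hle, hwf⟩ := h
    obtain ⟨V, hV, hvV⟩ := hv
    have hA : (ψ.inner : Set (Formula N AP × (D → ℕ))) ⊆ (nu X ψ).inner :=
      fun x hx Y hY => Set.mem_insert_of_mem _ (hx Y hY)
    have hwon : ∀ u ∈ V, ψ.LocallyHolds tra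
        (Won tra B f M ψ.inner ((nu X ψ).exits W ∪ {z | z.1 = var X ∧ z.2 ∈ V})) u :=
      fun u hu => (ih hwf (hV hu)).mono (Won.mono subset_rfl (exits_update subset_rfl))
    refine (hwon v hvV).mono ?_
    rintro x ⟨G⟩
    -- All exits for `X` lie in the post-fixpoint `V`, where the body is justified again with exits
    -- in `V`. Looping is harmless because `f X` is even and bounds all inner priorities from below.
    refine G.loop (obligationStep_mono tra B) hA ?_ he ?_ ?_
    · rintro ⟨_, u'⟩ ⟨rfl, hu'⟩
      refine ⟨fun Y hY => ?_, ?_⟩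
      · cases hY
        exact Set.mem_insert _ _
      · simp only [obligationStep, unfold, hB]
        exact hwon u' hu'
    · rintro ⟨_, u'⟩ ⟨rfl, -⟩
      rfl
    · rintro ⟨χ, u'⟩ hχ
      cases χ with
      | var Y => exact hle Y (hχ Y rfl)
      | _ => exact hM

/-- A closed formula that holds has a strategy without exits. -/
theorem WellFormed.nonempty_strategy {ψ : Formula N AP} (h : ψ.WellFormed tra B f M)
    (hcl : ψ.freeVars = ∅) {W : ℕ → Set (D → ℕ)} {v : D → ℕ} (hv : v ∈ ψ.sem tra W) :
    Nonempty (Strategy (obligationStep tra B) (fun x => x.1.prio f M) Set.univ ∅ (ψ, v)) := by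
  obtain ⟨G⟩ := mem_won_of_next (.inr h) hv fun h => h.locallyHolds hv
  refine G.mono (Set.subset_univ _) ?_
  rintro x ⟨Y, hY, -⟩
  rwa [hcl] at hY

/-! ### Dual formulae -/

/-- The formula that expresses the complement. Negated subformulae are kept and negated again. -/
def dual : Formula N AP → Formula N AP
  | test δ π => neg (test δ π)
  | var X => var X
  | neg ψ => neg (neg ψ)
  | or ψ₁ ψ₂ => and ψ₁.dual ψ₂.dual
  | and ψ₁ ψ₂ => or ψ₁.dual ψ₂.dual
  | nextW Δ ψ => nextD Δ ψ.dual
  | nextD Δ ψ => nextW Δ ψ.dual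
  | mu X ψ => nu X ψ.dual
  | nu X ψ => mu X ψ.dual

theorem freeVars_dual (ψ : Formula N AP) : ψ.dual.freeVars = ψ.freeVars := by
  induction ψ <;> simp_all [dual, freeVars]

theorem boundVars_dual (ψ : Formula N AP) : ψ.dual.boundVars = ψ.boundVars := by
  induction ψ <;> simp_all [dual, boundVars]

theorem unfold_dual (ψ : Formula N AP) : ψ.dual.unfold (fun X => (B X).dual) =
    (ψ.unfold B).dual := by
  cases ψ <;> rfl

theorem prio_dual (ψ : Formula N AP) :
    ψ.dual.prio (fun X => f X + 1) (M + 1) = ψ.prio f M + 1 := by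
  cases ψ <;> rfl

/-- Raising all priorities by one flips their parities, as the exchange of `mu` and `nu` requires,
and keeps their order. -/
theorem WellFormed.dual {ψ : Formula N AP} (h : ψ.WellFormed tra B f M) :
    ψ.dual.WellFormed tra (fun X => (B X).dual) (fun X => f X + 1) (M + 1) := by
  have hnext : ∀ ψ : Formula N AP, (∃ X, ψ = var X) → ∃ X, ψ.dual = var X := by
    rintro _ ⟨X, rfl⟩
    exact ⟨X, rfl⟩
  induction ψ with
  | test => exact fun _ _ => rfl
  | var => exact h.elim
  | neg ψ =>
    intro W W'
    simp only [sem]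
    rw [h W W']
  | or _ _ ih₁ ih₂ => exact ⟨ih₁ h.1, ih₂ h.2⟩
  | and _ _ ih₁ ih₂ => exact ⟨ih₁ h.1, ih₂ h.2⟩
  | nextW _ _ ih => exact h.imp (hnext _) ih
  | nextD _ _ ih => exact h.imp (hnext _) ih
  | mu X ψ ih =>
    obtain ⟨hB, he, hM, hle, hwf⟩ := h
    refine ⟨congrArg _ hB, he.add_one, Nat.succ_le_succ hM, fun Y hY => ?_, ih hwf⟩
    rw [boundVars_dual] at hY
    exact Nat.succ_le_succ (hle Y hY)
  | nu X ψ ih =>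
    obtain ⟨hB, he, hM, hle, hwf⟩ := h
    refine ⟨congrArg _ hB, he.add_one, Nat.succ_le_succ hM, fun Y hY => ?_, ih hwf⟩
    rw [boundVars_dual] at hY
    exact Nat.succ_le_succ (hle Y hY)

/-- Complementation exchanges pre-fixpoints of the body with post-fixpoints of its dual. Kept
negations cause no trouble, since their operands do not depend on the variable assignment. -/
theorem WellFormed.sem_dual {ψ : Formula N AP} (h : ψ.WellFormed tra B f M)
    (W : ℕ → Set (D → ℕ)) : ψ.dual.sem tra W = (ψ.sem tra fun X => (W X)ᶜ)ᶜ := by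
  have hnext : ∀ {ψ : Formula N AP} {W : ℕ → Set (D → ℕ)},
      (ψ.WellFormed tra B f M → ψ.dual.sem tra W = (ψ.sem tra fun X => (W X)ᶜ)ᶜ) →
      ((∃ X, ψ = var X) ∨ ψ.WellFormed tra B f M) →
      ψ.dual.sem tra W = (ψ.sem tra fun X => (W X)ᶜ)ᶜ := by
    rintro ψ W ih (⟨X, rfl⟩ | h)
    · simp [Formula.dual, sem]
    · exact ih h
  have hupdate : ∀ (W : ℕ → Set (D → ℕ)) (X : ℕ) (V : Set (D → ℕ)),
      (fun Y => (Function.update W X V Y)ᶜ) = Function.update (fun Y => (W Y)ᶜ) X Vᶜ := by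
    intro W X V
    funext Y
    by_cases hY : Y = X
    · subst hY
      simp
    · simp [hY]
  induction ψ generalizing W with
  | test => rfl
  | var => exact h.elim
  | neg ψ =>
    simp only [Formula.dual, sem]
    rw [h W]
  | or ψ₁ ψ₂ ih₁ ih₂ => simp only [Formula.dual, sem, ih₁ h.1, ih₂ h.2, Set.compl_union]
  | and ψ₁ ψ₂ ih₁ ih₂ => simp only [Formula.dual, sem, ih₁ h.1, ih₂ h.2, Set.compl_inter]
  | nextW Δ ψ ih =>
    simp only [Formula.dual, sem, hnext (fun h => ih h W) h]
    ext v
    simp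
  | nextD Δ ψ ih =>
    simp only [Formula.dual, sem, hnext (fun h => ih h W) h]
    ext v
    simp
  | mu X ψ ih =>
    simp only [Formula.dual, sem, ih h.2.2.2.2, hupdate]
    ext v
    simp only [Set.mem_sUnion, Set.mem_ofPred_eq, Set.mem_compl_iff, Set.mem_sInter, not_forall]
    constructor
    · rintro ⟨V, hV, hv⟩
      exact ⟨Vᶜ, Set.subset_compl_comm.1 hV, fun h => h hv⟩
    · rintro ⟨V, hV, hv⟩
      refine ⟨Vᶜ, ?_, hv⟩
      rw [compl_compl]
      exact Set.compl_subset_compl.2 hV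
  | nu X ψ ih =>
    simp only [Formula.dual, sem, ih h.2.2.2.2, hupdate]
    ext v
    simp only [Set.mem_sUnion, Set.mem_ofPred_eq, Set.mem_compl_iff, Set.mem_sInter, not_exists,
      not_and]
    constructor
    · intro h V hV hv
      refine h Vᶜ ?_ hv
      rw [compl_compl]
      exact Set.compl_subset_compl.2 hV
    · intro h V hV
      by_contra hv
      exact h Vᶜ (Set.compl_subset_comm.1 hV) hv

end Formula

end Obligations

end Mumbling
namespace Mumbling

/-! ### Runs and strategies -/

section Runs

namespace PosBool

variable {Q : Type*}

theorem Sat.mono {S S' : Set Q} (h : S ⊆ S') {F : PosBool Q} (hF : F.Sat S) : F.Sat S' := by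
  induction F with
  | atom q => exact h hF
  | or _ _ ih₁ ih₂ => exact hF.imp ih₁ ih₂
  | and _ _ ih₁ ih₂ => exact hF.imp ih₁ ih₂

theorem Sat.nonempty {S : Set Q} {F : PosBool Q} (hF : F.Sat S) : S.Nonempty := by
  induction F with
  | atom q => exact ⟨q, hF⟩
  | or _ _ ih₁ ih₂ => exact hF.elim ih₁ ih₂
  | and _ _ ih₁ _ => exact ih₁ hF.1

/-- The verifier (for `pol = true`) or the refuter (for `pol = false`) can force the choice of an
element of `X` in the evaluation of `F`. -/
def Forces (pol : Bool) (F : PosBool Q) (X : Set Q) : Prop :=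
  if pol then F.Sat X else ∀ S, F.Sat S → (S ∩ X).Nonempty

variable {pol : Bool} {X Y : Set Q}

theorem Forces.mono {F : PosBool Q} (h : F.Forces pol X) (hXY : X ⊆ Y) : F.Forces pol Y := by
  cases pol
  · exact fun S hS => (h S hS).mono (Set.inter_subset_inter_right _ hXY)
  · exact Sat.mono hXY h

theorem forces_atom {q : Q} (h : q ∈ X) : (atom q).Forces pol X := by
  cases pol
  · exact fun S hS => ⟨q, hS, h⟩
  · exact h

end PosBool

namespace APA

variable {A : Type*} {𝒜 : APA A} {w : ℕ → A} {Γ : Type*}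
  {Inv : ℕ → 𝒜.State → Γ → Prop} {Rel : ℕ → 𝒜.State × Γ → 𝒜.State × Γ → Prop}

/-- The nodes visited by following child indices from the root. -/
def walk {V : Type*} (succ : V → List V) (v₀ : V) (t : List ℕ) : Option V :=
  t.foldl (fun o n => o.bind fun v => (succ v)[n]?) (some v₀)

theorem walk_append {V : Type*} (succ : V → List V) (v₀ : V) (t : List ℕ) (n : ℕ) :
    walk succ v₀ (t ++ [n]) = (walk succ v₀ t).bind fun v => (succ v)[n]? := by
  simp [walk]

theorem isTree_walk {V : Type*} {succ : V → List V} (h : ∀ v, succ v ≠ []) (v₀ : V) :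
    IsTree {t | (walk succ v₀ t).isSome} where
  root := rfl
  parent t n ht := by
    simp only [Set.mem_ofPred_eq, walk_append] at ht ⊢
    exact Option.isSome_of_isSome_bind ht
  sibling t n m ht hm := by
    simp only [Set.mem_ofPred_eq, walk_append] at ht ⊢
    obtain ⟨v, hv⟩ := Option.isSome_iff_exists.1 (Option.isSome_of_isSome_bind ht)
    simp only [hv, Option.bind_some, isSome_getElem?] at ht ⊢
    exact hm.trans ht
  child t ht := by
    obtain ⟨v, hv⟩ := Option.isSome_iff_exists.1 ht
    refine ⟨0, ?_⟩
    simp only [Set.mem_ofPred_eq, walk_append, hv, Option.bind_some, isSome_getElem?]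
    exact List.length_pos_of_ne_nil (h v)

/-- A word is accepted if the verifier has a winning strategy with memory `Γ`. -/
theorem mem_language_of_strategy {q₀ : 𝒜.State} (hq₀ : q₀ ∈ 𝒜.init) {γ₀ : Γ} (h₀ : Inv 0 q₀ γ₀)
    (hstep : ∀ i q γ, Inv i q γ →
      (𝒜.trans q (w i)).Sat {q' | ∃ γ', Inv (i + 1) q' γ' ∧ Rel i (q, γ) (q', γ')})
    (hgood : ∀ p : ℕ → 𝒜.State × Γ, (∀ i, Inv i (p i).1 (p i).2) →
      (∀ i, Rel i (p i) (p (i + 1))) → ParityGood fun i => 𝒜.prio (p i).1) :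
    w ∈ 𝒜.language := by
  classical
  have := 𝒜.finite
  let V := {x : ℕ × 𝒜.State × Γ // Inv x.1 x.2.1 x.2.2}
  have hsucc : ∀ v : V, ∃ l : List V,
      (𝒜.trans v.1.2.1 (w v.1.1)).Sat {s | s ∈ l.map fun y => y.1.2.1} ∧
      ∀ y ∈ l, y.1.1 = v.1.1 + 1 ∧ Rel v.1.1 v.1.2 y.1.2 := by
    rintro ⟨⟨i, q, γ⟩, hv⟩
    let X := {q' | ∃ γ', Inv (i + 1) q' γ' ∧ Rel i (q, γ) (q', γ')}
    have hX : ∀ q' : X, ∃ γ', Inv (i + 1) q' γ' ∧ Rel i (q, γ) (q', γ') := fun q' => q'.2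
    choose g hg using hX
    let F : X → V := fun q' => ⟨(i + 1, q', g q'), (hg q').1⟩
    have hfin : (Set.univ : Set X).Finite := Set.toFinite _
    -- One memory value is fixed for each possible next state; as there are finitely many states,
    -- all of them can be listed as children.
    refine ⟨hfin.toFinset.toList.map F, (hstep i q γ hv).mono fun q' hq' => ?_, fun y hy => ?_⟩
    · simp only [Set.mem_ofPred_eq, List.map_map, List.mem_map, Finset.mem_toList,
        Set.Finite.mem_toFinset]
      exact ⟨⟨q', hq'⟩, trivial, rfl⟩
    · simp only [List.mem_map] at hy
      obtain ⟨q', -, rfl⟩ := hy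
      exact ⟨rfl, (hg q').2⟩
  choose succ hsat hsucc using hsucc
  let v₀ : V := ⟨(0, q₀, γ₀), h₀⟩
  -- The default label only concerns sequences outside the tree.
  let r : List ℕ → ℕ × 𝒜.State := fun t =>
    (walk succ v₀ t).elim (0, q₀) fun v => (v.1.1, v.1.2.1)
  have hne : ∀ v, succ v ≠ [] := by
    intro v hv
    obtain ⟨s, hs⟩ := (hsat v).nonempty
    simp [hv] at hs
  refine ⟨q₀, hq₀, {t | (walk succ v₀ t).isSome}, r, ⟨isTree_walk hne v₀, rfl, ?_⟩, ?_⟩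
  · intro t ht
    obtain ⟨v, hv⟩ := Option.isSome_iff_exists.1 ht
    have hr : r t = (v.1.1, v.1.2.1) := by simp only [r, hv, Option.elim]
    refine ⟨(succ v).map fun y => y.1.2.1, ?_, ?_, ?_⟩
    · rw [hr]
      exact hsat v
    · intro n
      simp [walk_append, hv]
    · intro n hn
      have hn' : n < (succ v).length := by simpa using hn
      have hw : walk succ v₀ (t ++ [n]) = some (succ v)[n] := by
        rw [walk_append, hv, Option.bind_some, List.getElem?_eq_getElem hn']
      rw [hr]
      simp only [r, hw, Option.elim, List.getElem_map,
        (hsucc v _ (List.getElem_mem hn')).1]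
  · rintro p ⟨hp0, hp⟩
    have hsome : ∀ i, ∃ v, walk succ v₀ (p i) = some v := by
      intro i
      cases i with
      | zero => exact ⟨v₀, by rw [hp0]; rfl⟩
      | succ i => exact Option.isSome_iff_exists.1 (hp i).1
    choose x hx using hsome
    have hmem : ∀ i, x (i + 1) ∈ succ (x i) := by
      intro i
      obtain ⟨-, n, hn⟩ := hp i
      have h := hx (i + 1)
      rw [hn, walk_append, hx i, Option.bind_some] at h
      exact List.mem_of_getElem? h
    have hidx : ∀ i, (x i).1.1 = i := by
      intro i
      induction i with
      | zero =>
        have h := hx 0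
        rw [hp0] at h
        rw [← Option.some.inj (h : some v₀ = _)]
      | succ i ih => rw [(hsucc _ _ (hmem i)).1, ih]
    have h := hgood (fun i => (x i).1.2) (fun i => by simpa only [hidx i] using (x i).2)
      (fun i => by simpa only [hidx i] using (hsucc _ _ (hmem i)).2)
    have hr : ∀ i, (r (p i)).2 = (x i).1.2.1 := fun i => by simp only [r, hx, Option.elim]
    simpa only [ParityGood, hr] using h

/-- If a word is accepted, then every strategy of the refuter with memory `Γ` admits a path that
satisfies the parity condition. -/
theorem exists_good_path_of_mem_language (hw : w ∈ 𝒜.language)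
    (h₀ : ∀ q₀ ∈ 𝒜.init, ∃ γ₀, Inv 0 q₀ γ₀)
    (hstep : ∀ i q γ, Inv i q γ → ∀ S, (𝒜.trans q (w i)).Sat S →
      (S ∩ {q' | ∃ γ', Inv (i + 1) q' γ' ∧ Rel i (q, γ) (q', γ')}).Nonempty) :
    ∃ p : ℕ → 𝒜.State × Γ, (∀ i, Inv i (p i).1 (p i).2) ∧ (∀ i, Rel i (p i) (p (i + 1))) ∧
      ParityGood fun i => 𝒜.prio (p i).1 := by
  obtain ⟨q₀, hq₀, T, r, hrun, hacc⟩ := hw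
  obtain ⟨γ₀, h₀⟩ := h₀ q₀ hq₀
  let V := {x : List ℕ × Γ // x.1 ∈ T ∧ Inv (r x.1).1 (r x.1).2 x.2}
  have hnext : ∀ x : V, ∃ y : V, (∃ n, y.1.1 = x.1.1 ++ [n]) ∧
      (r y.1.1).1 = (r x.1.1).1 + 1 ∧
      Rel (r x.1.1).1 ((r x.1.1).2, x.1.2) ((r y.1.1).2, y.1.2) := by
    rintro ⟨⟨t, γ⟩, ht, hinv⟩
    obtain ⟨S, hsat, hch, hlab⟩ := hrun.step t ht
    -- The labels of the children satisfy the transition formula, so the refuter can force one of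
    -- them.
    obtain ⟨q', hq', γ', hinv', hrel⟩ := hstep _ _ _ hinv _ hsat
    obtain ⟨n, hn, rfl⟩ := List.mem_iff_getElem.1 hq'
    have h := hlab n hn
    refine ⟨⟨(t ++ [n], γ'), (hch n).2 hn, ?_⟩, ⟨n, rfl⟩, ?_, ?_⟩
    · simpa only [h] using hinv'
    · simp only [h]
    · simpa only [h] using hrel
  choose F hF1 hF2 hF3 using hnext
  have hroot : r [] = (0, q₀) := hrun.root
  let x₀ : V := ⟨([], γ₀), hrun.tree.root, by simpa only [hroot] using h₀⟩
  let x : ℕ → V := fun i => F^[i] x₀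
  have hx : ∀ i, x (i + 1) = F (x i) := fun i => Function.iterate_succ_apply' F i x₀
  have hidx : ∀ i, (r (x i).1.1).1 = i := by
    intro i
    induction i with
    | zero =>
      change (r []).1 = 0
      rw [hroot]
    | succ i ih => rw [hx, hF2, ih]
  refine ⟨fun i => ((r (x i).1.1).2, (x i).1.2), fun i => ?_, fun i => ?_, ?_⟩
  · simpa only [hidx i] using (x i).2.2
  · have h := hF3 (x i)
    rw [hidx i, ← hx i] at h
    exact h
  · refine hacc (fun i => (x i).1.1) ⟨rfl, fun i => ⟨(x (i + 1)).2.1, ?_⟩⟩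
    simp only [hx i]
    exact hF1 (x i)

end APA

/-- Sequences that stutter, but make progress infinitely often, arise from sequences without
stuttering. -/
theorem exists_of_stuttering {S : Type*} {E : S → S → Prop} {c : ℕ → ℕ} {g : ℕ → S} (h0 : c 0 = 0)
    (hstep : ∀ i, (c (i + 1) = c i ∧ g (i + 1) = g i) ∨
      (c (i + 1) = c i + 1 ∧ E (g i) (g (i + 1))))
    (hprog : ∀ i, ∃ i' ≥ i, c (i' + 1) = c i' + 1) :
    ∃ s : ℕ → S, (∀ j, E (s j) (s (j + 1))) ∧
      ∀ P : S → Prop, (∃ᶠ j in Filter.atTop, P (s j)) ↔ ∃ᶠ i in Filter.atTop, P (g i) := by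
  have hmono : Monotone c := monotone_nat_of_le_succ fun i => by rcases hstep i with h | h <;> omega
  have hreach : ∀ j, ∃ i, c i = j ∧ c (i + 1) = j + 1 := by
    have hunb : ∀ j, ∃ i, j ≤ c i := by
      intro j
      induction j with
      | zero => exact ⟨0, Nat.zero_le _⟩
      | succ j ih =>
        obtain ⟨i, hi⟩ := ih
        obtain ⟨i', hi', h⟩ := hprog i
        exact ⟨i' + 1, by have := hmono hi'; omega⟩
    intro j
    classical
    -- The predecessor of the first index whose count is at least `j + 1` is the last index with
    -- count `j`, since counts grow by at most one.
    have hex := hunb (j + 1)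
    obtain ⟨m, hm⟩ : ∃ m, Nat.find hex = m + 1 :=
      Nat.exists_eq_succ_of_ne_zero fun h => by
        have := Nat.find_spec hex
        rw [h, h0] at this
        omega
    have h1 := Nat.find_spec hex
    have h2 := Nat.find_min hex (m := m) (by omega)
    rw [hm] at h1
    refine ⟨m, ?_⟩
    rcases hstep m with h | h <;> omega
  have hconst : ∀ i k, c (i + k) = c i → g (i + k) = g i := by
    intro i k hk
    induction k with
    | zero => rfl
    | succ k ih =>
      have h1 := hmono (Nat.le_add_right i k)
      have h2 := hmono (Nat.le_add_right (i + k) 1)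
      rw [← add_assoc] at hk ⊢
      rcases hstep (i + k) with h | h
      · rw [h.2, ih (by omega)]
      · omega
  have hconst' : ∀ i i', c i = c i' → g i = g i' := by
    intro i i' h
    rcases le_total i i' with hle | hle
    · obtain ⟨k, rfl⟩ := Nat.exists_eq_add_of_le hle
      exact (hconst i k h.symm).symm
    · obtain ⟨k, rfl⟩ := Nat.exists_eq_add_of_le hle
      exact hconst i' k h
  choose idx hidx hidx' using hreach
  have hg : ∀ i, g i = g (idx (c i)) := fun i => hconst' _ _ (hidx _).symm
  refine ⟨fun j => g (idx j), fun j => ?_, fun P => ?_⟩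
  · have : g (idx (j + 1)) = g (idx j + 1) := hconst' _ _ (by rw [hidx, hidx'])
    simp only [this]
    rcases hstep (idx j) with h | h
    · have := hidx j
      have := hidx' j
      omega
    · exact h.2
  · simp only [Filter.frequently_atTop]
    constructor
    · intro h a
      obtain ⟨b, hb, hP⟩ := h (c a + 1)
      refine ⟨idx b, ?_, hP⟩
      by_contra hlt
      have := hmono (not_le.1 hlt).le
      have := hidx b
      omega
    · intro h a
      obtain ⟨b, hb, hP⟩ := h (idx a)
      refine ⟨c b, ?_, by rwa [← hg]⟩
      have := hmono hb
      rwa [hidx] at this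

end Runs

end Mumbling
namespace Mumbling

/-! ### The automaton of a formula -/

section Automaton

universe u v
variable {N : Type u} {AP : Type v} {D : Finset N} {n : ℕ}

open Formula

/-- The states: `inl` contains the absorbing states, and `inr (k, b)` is waiting for the next tuple
of sets of propositions in order to verify the formula with index `k`. The flag `b` tells whether
such a tuple has to exist. -/
abbrev AutState (n : ℕ) := Bool ⊕ (Fin n × Bool)

open Classical in
/-- The state that waits in order to verify `ψ`. -/
noncomputable def waitState (φ : Fin n → Formula N AP) (ψ : Formula N AP) (b : Bool) :
    AutState n :=
  if h : ∃ k, φ k = ψ then .inr (h.choose, b) else .inl false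

theorem waitState_eq {φ : Fin n → Formula N AP} {ψ : Formula N AP} (h : ∃ k, φ k = ψ) (b : Bool) :
    ∃ k, waitState φ ψ b = .inr (k, b) ∧ φ k = ψ :=
  ⟨h.choose, dif_pos h, h.choose_spec⟩

/-- The test of an atomic proposition on a tuple of sets of propositions. -/
def testHolds (P : D → Set AP) (δ : TraceFormula AP) (π : N) : Prop :=
  ∃ p, δ = .atom p ∧ ∃ h : π ∈ D, p ∈ P ⟨π, h⟩

open Classical in
/-- The transition formula for a formula and a tuple of sets of propositions. -/
noncomputable def evalFormula (φ : Fin n → Formula N AP) (P : D → Set AP) :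
    Formula N AP → PosBool (AutState n)
  | .test δ π => .atom (.inl (decide (testHolds P δ π)))
  | .var _ => .atom (.inl false)
  | .neg ψ => .atom (.inl (decide (∃ δ π, ψ = test δ π ∧ ¬ testHolds P δ π)))
  | .or ψ₁ ψ₂ => .or (evalFormula φ P ψ₁) (evalFormula φ P ψ₂)
  | .and ψ₁ ψ₂ => .and (evalFormula φ P ψ₁) (evalFormula φ P ψ₂)
  | .nextW _ ψ => .atom (waitState φ ψ true)
  | .nextD _ ψ => .atom (waitState φ ψ false)
  | .mu _ ψ => evalFormula φ P ψ
  | .nu _ ψ => evalFormula φ P ψ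

/-- The transition function. -/
noncomputable def autTrans (φ : Fin n → Formula N AP) (B : ℕ → Formula N AP) :
    AutState n → Letter D AP → PosBool (AutState n)
  | .inl b, _ => .atom (.inl b)
  | .inr (k, _), .props P => evalFormula φ P ((φ k).unfold B)
  | .inr (k, b), .call => .atom (.inr (k, b))
  | .inr (k, b), .ret => .atom (.inr (k, b))
  -- The awaited step is undefined here, so `nextW` (flag `true`) fails and `nextD` succeeds.
  | .inr (_, b), .top => .atom (.inl !b)

/-- The priorities of the states. -/
def autPrio (φ : Fin n → Formula N AP) (f : ℕ → ℕ) (M : ℕ) : AutState n → ℕ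
  | .inl b => (!b).toNat
  | .inr (k, _) => (φ k).prio f M

/-- The alternating parity automaton for the formula `ψ`. -/
noncomputable def formulaAPA (D : Finset N) (φ : Fin n → Formula N AP) (B : ℕ → Formula N AP)
    (f : ℕ → ℕ) (M : ℕ) (ψ : Formula N AP) : APA (Letter D AP) where
  State := AutState n
  finite := inferInstance
  -- The flag of an initial state is immaterial, since every encoding begins with a tuple.
  init := {q | ∃ k, q = .inr (k, true) ∧ φ k = ψ}
  trans := autTrans φ B
  prio := autPrio φ f M
  tt := .inl true
  ff := .inl false
  tt_ne_ff := by simp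
  prio_tt := rfl
  prio_ff := rfl
  trans_tt _ := rfl
  trans_ff _ := rfl

/-- Tests are atomic, negations only occur in front of atomic tests, all top-level next operators
use `Δ` and lead to formulae of the family `φ`. -/
def Admissible (Δ : N → TraceFormula AP) (φ : Fin n → Formula N AP) : Formula N AP → Prop
  | .test δ _ => ∃ p, δ = .atom p
  | .var _ => True
  | .neg ψ => ∃ p π, ψ = test (.atom p) π
  | .or ψ₁ ψ₂ => Admissible Δ φ ψ₁ ∧ Admissible Δ φ ψ₂
  | .and ψ₁ ψ₂ => Admissible Δ φ ψ₁ ∧ Admissible Δ φ ψ₂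
  | .nextW Δ' ψ => Δ' = Δ ∧ ∃ k, φ k = ψ
  | .nextD Δ' ψ => Δ' = Δ ∧ ∃ k, φ k = ψ
  | .mu _ ψ => Admissible Δ φ ψ
  | .nu _ ψ => Admissible Δ φ ψ

/-! ### Local correctness of the transition formulae, for both players -/

/-- The formula itself or its dual. -/
def polar : Bool → Formula N AP → Formula N AP
  | true, ψ => ψ
  | false, ψ => ψ.dual

theorem unfold_polar (pol : Bool) (B : ℕ → Formula N AP) (ψ : Formula N AP) :
    (polar pol ψ).unfold (fun X => polar pol (B X)) = polar pol (ψ.unfold B) := by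
  cases pol
  · exact unfold_dual ψ
  · rfl

theorem prio_polar (pol : Bool) (f : ℕ → ℕ) (M : ℕ) (ψ : Formula N AP) :
    (polar pol ψ).prio (fun X => f X + (!pol).toNat) (M + (!pol).toNat) =
      ψ.prio f M + (!pol).toNat := by
  cases pol
  · exact prio_dual ψ
  · rfl

variable {tra : D → Trace AP} {Δ : N → TraceFormula AP} {φ : Fin n → Formula N AP}
  {B : ℕ → Formula N AP} {f : ℕ → ℕ} {M : ℕ}

theorem mem_sem_test_atom {p : AP} {π : N} {W : ℕ → Set (D → ℕ)} {v : D → ℕ} :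
    v ∈ (test (.atom p) π).sem tra W ↔
      testHolds (fun π => (tra π).props (v π)) (.atom p) π := by
  constructor
  · rintro ⟨h, hp⟩
    exact ⟨p, rfl, h, hp⟩
  · rintro ⟨q, hq, h, hp⟩
    cases hq
    exact ⟨h, hp⟩

/-- The states that a player with obligations `O` for the next vector is able to handle. -/
def NextStates (tra : D → Trace AP) (Δ : N → TraceFormula AP) (φ : Fin n → Formula N AP)
    (pol : Bool) (O : Set (Formula N AP × (D → ℕ))) (v : D → ℕ) : Set (AutState n) :=
  {q | q = .inl pol ∨ ∃ k b, q = .inr (k, b) ∧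
    ((∃ v', succW Δ tra v = some v' ∧ (polar pol (φ k), v') ∈ O) ∨
      -- No further tuple will come; on `⊤` the flag `!pol` leads to the absorbing state that
      -- favours the player.
      (succW Δ tra v = none ∧ b = !pol))}

-- For the verifier, `evalFormula` mirrors local justification clause by clause. For the refuter the
-- dual exchanges the connectives: a set satisfying a disjunction satisfies one side, and both sides
-- are refuted; a set satisfying a conjunction satisfies both, and the refuted one is used.
open Classical in
theorem forces_evalFormula {pol : Bool} {O : Set (Formula N AP × (D → ℕ))} {v : D → ℕ}
    {ψ : Formula N AP} (hψ : Admissible Δ φ ψ) (h : (polar pol ψ).LocallyHolds tra O v) :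
    (evalFormula φ (fun π => (tra π).props (v π)) ψ).Forces pol
      (NextStates tra Δ φ pol O v) := by
  have hatom : ∀ b, b = pol → (PosBool.atom (.inl b)).Forces pol (NextStates tra Δ φ pol O v) := by
    rintro b rfl
    exact PosBool.forces_atom (.inl rfl)
  have hnext : ∀ (ψ : Formula N AP) b, (∃ k, φ k = ψ) →
      ((∃ v', succW Δ tra v = some v' ∧ (polar pol ψ, v') ∈ O) ∨
        (succW Δ tra v = none ∧ b = !pol)) →
      (PosBool.atom (waitState φ ψ b)).Forces pol (NextStates tra Δ φ pol O v) := by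
    intro ψ b hk h
    obtain ⟨k, hq, rfl⟩ := waitState_eq hk b
    exact PosBool.forces_atom (.inr ⟨k, b, hq, h⟩)
  have hall : ∀ ψ : Formula N AP, (∀ v', succW Δ tra v = some v' → (polar pol ψ, v') ∈ O) →
      ((∃ v', succW Δ tra v = some v' ∧ (polar pol ψ, v') ∈ O) ∨ succW Δ tra v = none) := by
    intro ψ h
    rcases hs : succW Δ tra v with _ | v'
    · exact .inr rfl
    · exact .inl ⟨v', rfl, h v' hs⟩
  induction ψ with
  | test δ π =>
    obtain ⟨p, rfl⟩ := hψ
    refine hatom _ ?_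
    cases pol
    · exact decide_eq_false fun h' => h (mem_sem_test_atom.2 h')
    · exact decide_eq_true (mem_sem_test_atom.1 h)
  | var => cases pol <;> exact h.elim
  | neg ψ =>
    obtain ⟨p, π, rfl⟩ := hψ
    refine hatom _ ?_
    cases pol
    · refine decide_eq_false ?_
      rintro ⟨_, _, heq, hn⟩
      cases heq
      exact h fun h' => hn (mem_sem_test_atom.1 h')
    · exact decide_eq_true ⟨_, _, rfl, fun h' => h (mem_sem_test_atom.2 h')⟩
  | or ψ₁ ψ₂ ih₁ ih₂ =>
    cases pol
    · exact fun S hS => hS.elim (ih₁ hψ.1 h.1 S) (ih₂ hψ.2 h.2 S)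
    · exact Or.imp (ih₁ hψ.1) (ih₂ hψ.2) h
  | and ψ₁ ψ₂ ih₁ ih₂ =>
    cases pol
    · exact fun S hS => Or.elim h (fun h => ih₁ hψ.1 h S hS.1) (fun h => ih₂ hψ.2 h S hS.2)
    · exact And.imp (ih₁ hψ.1) (ih₂ hψ.2) h
  | nextW Δ' ψ =>
    obtain ⟨rfl, hk⟩ := hψ
    refine hnext ψ true hk ?_
    cases pol
    · exact (hall ψ h).imp_right fun h => ⟨h, rfl⟩
    · exact .inl h
  | nextD Δ' ψ =>
    obtain ⟨rfl, hk⟩ := hψ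
    refine hnext ψ false hk ?_
    cases pol
    · exact .inl h
    · exact (hall ψ h).imp_right fun h => ⟨h, rfl⟩
  | mu _ _ ih | nu _ _ ih => cases pol <;> exact ih hψ h

/-! ### Words that encode a trace assignment -/

/-- The next `j` applications of `succ_Δ^w` to `(0, …, 0)` are defined. -/
def StepsDefined (Δ : N → TraceFormula AP) (tra : D → Trace AP) (j : ℕ) : Prop :=
  ∀ k < j, WellAligned Δ tra (prog Δ tra k)

/-- The word `w` encodes `tra`, where `c i` is the number of tuples among the first `i` letters. -/
structure Encodes (Δ : N → TraceFormula AP) (tra : D → Trace AP) (w : ℕ → Letter D AP)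
    (c : ℕ → ℕ) : Prop where
  zero : c 0 = 0
  letter : ∀ i, StepsDefined Δ tra (c i) →
    (w i = .props (labels Δ tra (c i)) ∧ c (i + 1) = c i + 1) ∨
      ((w i = .call ∨ w i = .ret) ∧ c (i + 1) = c i)
  top : ∀ i, ¬ StepsDefined Δ tra (c i) → w i = .top
  progress : ∀ i, StepsDefined Δ tra (c i) → ∃ i' ≥ i, c (i' + 1) = c i' + 1

theorem prog_succ (Δ : N → TraceFormula AP) (tra : D → Trace AP) (j : ℕ) :
    prog Δ tra (j + 1) = succAll Δ tra (prog Δ tra j) :=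
  Function.iterate_succ_apply' _ _ _

theorem stepsDefined_succ {j : ℕ} : StepsDefined Δ tra (j + 1) ↔
    StepsDefined Δ tra j ∧ WellAligned Δ tra (prog Δ tra j) := by
  simp only [StepsDefined, Nat.lt_succ_iff_lt_or_eq, or_imp, forall_and, forall_eq]

theorem succW_eq_some {v v' : D → ℕ} :
    succW Δ tra v = some v' ↔ WellAligned Δ tra v ∧ succAll Δ tra v = v' := by
  simp [succW]

theorem succW_eq_none {v : D → ℕ} : succW Δ tra v = none ↔ ¬ WellAligned Δ tra v := by
  simp [succW]

/-! ### Plays on an encoding and correctness of the automaton -/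

variable {pol : Bool} {w : ℕ → Letter D AP} {c : ℕ → ℕ} {ψ : Formula N AP}
  {A : Set (Formula N AP × (D → ℕ))} {x₀ : Formula N AP × (D → ℕ)}
  (G : Strategy (obligationStep tra fun X => polar pol (B X))
    (fun x => x.1.prio (fun X => f X + (!pol).toNat) (M + (!pol).toNat)) A ∅ x₀)

/-- The invariant of a play in which one player follows the strategy `G`. -/
def PlayInv (Δ : N → TraceFormula AP) (φ : Fin n → Formula N AP) (c : ℕ → ℕ) (i : ℕ)
    (q : AutState n) : Option G.Node → Prop
  | none => q = .inl pol ∨ ∃ k, q = .inr (k, !pol) ∧ ¬ StepsDefined Δ tra (c i)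
  | some s => ∃ k b, q = .inr (k, b) ∧ G.label s = (polar pol (φ k), prog Δ tra (c i)) ∧
      StepsDefined Δ tra (c i)

/-- The steps of a play in which one player follows the strategy `G`. -/
def PlayStep (c : ℕ → ℕ) (i : ℕ) : AutState n × Option G.Node → AutState n × Option G.Node → Prop
  | (_, none), (q', o) => o = none ∧ q' = .inl pol
  | (_, some _), (_, none) => True
  | (q, some s), (q', some s') => (c (i + 1) = c i ∧ (q', s') = (q, s)) ∨
      (c (i + 1) = c i + 1 ∧ G.edge s s')

/-- On a tuple the player moves along an edge of `G`, or drops the memory once only an absorbing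
state or a favourable `⊤` lies ahead. On `call` and `ret` both the state and the node of `G` stay
put. -/
theorem forces_autTrans (hc : Encodes Δ tra w c) (hφ : ∀ k, Admissible Δ φ ((φ k).unfold B))
    {i : ℕ} {q : AutState n} {o : Option G.Node} (h : PlayInv G Δ φ c i q o) :
    (autTrans φ B q (w i)).Forces pol
      {q' | ∃ o', PlayInv G Δ φ c (i + 1) q' o' ∧ PlayStep G c i (q, o) (q', o')} := by
  cases o with
  | none =>
    have hpol : (Sum.inl pol : AutState n) ∈ {q' | ∃ o', PlayInv G Δ φ c (i + 1) q' o' ∧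
        PlayStep G c i (q, none) (q', o')} := ⟨none, .inl rfl, rfl, rfl⟩
    rcases h with rfl | ⟨k, rfl, h⟩
    · exact PosBool.forces_atom hpol
    · rw [hc.top i h]
      refine PosBool.forces_atom ?_
      simpa using hpol
  | some s =>
    obtain ⟨k, b, rfl, hlab, hdef⟩ := h
    rcases hc.letter i hdef with ⟨hw, hci⟩ | ⟨hw, hci⟩
    · rw [hw]
      rcases G.valid s with ⟨h, -⟩ | ⟨-, h⟩
      · exact h.elim
      rw [obligationStep, hlab, unfold_polar] at h
      refine (forces_evalFormula (hφ k) h).mono ?_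
      rintro q' (rfl | ⟨k', b', rfl, ⟨v', hv', s', hs', hlab'⟩ | ⟨hnone, rfl⟩⟩)
      · exact ⟨none, .inl rfl, trivial⟩
      · rw [succW_eq_some] at hv'
        refine ⟨some s', ⟨k', b', rfl, ?_, ?_⟩, .inr ⟨hci, hs'⟩⟩
        · rw [hlab', hci, prog_succ, hv'.2]
        · rw [hci, stepsDefined_succ]
          exact ⟨hdef, hv'.1⟩
      · refine ⟨none, .inr ⟨k', rfl, ?_⟩, trivial⟩
        rw [hci, stepsDefined_succ]
        exact fun h => succW_eq_none.1 hnone h.2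
    · have htrans : autTrans φ B (.inr (k, b)) (w i) = .atom (.inr (k, b)) := by
        rcases hw with hw | hw <;> rw [hw] <;> rfl
      rw [htrans]
      refine PosBool.forces_atom ⟨some s, ⟨k, b, rfl, ?_, ?_⟩, .inl ⟨hci, rfl⟩⟩
      · rw [hlab, hci]
      · rwa [hci]

/-- If the memory is ever dropped, the play ends in `.inl pol`, whose adjusted priority is `0` or
`2`. Otherwise it is a stuttering version of an infinite path of `G`, and stuttering does not affect
which priorities recur. -/
theorem parityGood_play (hc : Encodes Δ tra w c) (p : ℕ → AutState n × Option G.Node)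
    (hinv : ∀ i, PlayInv G Δ φ c i (p i).1 (p i).2)
    (hstep : ∀ i, PlayStep G c i (p i) (p (i + 1))) :
    ParityGood fun i => autPrio φ f M (p i).1 + (!pol).toNat := by
  by_cases hnone : ∃ i, (p i).2 = none
  · obtain ⟨i, hi⟩ := hnone
    have hstep' : ∀ j, (p j).2 = none → (p (j + 1)).2 = none ∧ (p (j + 1)).1 = .inl pol := by
      intro j hj
      have h := hstep j
      rcases hp : p j with ⟨q, o⟩
      rw [hp] at h hj
      subst hj
      exact h
    have hall : ∀ k, (p (i + 1 + k)).2 = none ∧ (p (i + 1 + k)).1 = .inl pol := by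
      intro k
      induction k with
      | zero => exact hstep' i hi
      | succ k ih => exact hstep' _ ih.1
    refine ParityGood.of_tail (i + 1) ?_
    simp only [(hall _).2, autPrio]
    refine ⟨(!pol).toNat + (!pol).toNat, ⟨?_, ?_⟩, Even.add_self _⟩
    · exact Filter.Frequently.of_forall fun _ => rfl
    · rintro k hk
      obtain ⟨_, h⟩ := Filter.Frequently.exists hk
      exact h.le
  · push Not at hnone
    choose s hs using fun i => Option.ne_none_iff_exists'.1 (hnone i)
    have hinv' : ∀ i, ∃ k b, (p i).1 = .inr (k, b) ∧
        G.label (s i) = (polar pol (φ k), prog Δ tra (c i)) ∧ StepsDefined Δ tra (c i) := by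
      intro i
      have h := hinv i
      rw [hs] at h
      exact h
    have hprio : ∀ i, autPrio φ f M (p i).1 + (!pol).toNat =
        (G.label (s i)).1.prio (fun X => f X + (!pol).toNat) (M + (!pol).toNat) := by
      intro i
      obtain ⟨k, b, hq, hlab, -⟩ := hinv' i
      rw [hq, hlab, prio_polar]
      rfl
    obtain ⟨t, ht, hfr⟩ := exists_of_stuttering (E := G.edge) (c := c) (g := s) hc.zero
      (fun i => by
        have h := hstep i
        rw [show p i = ((p i).1, some (s i)) from Prod.ext rfl (hs i),
          show p (i + 1) = ((p (i + 1)).1, some (s (i + 1))) from Prod.ext rfl (hs (i + 1))] at h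
        exact h.imp_left (And.imp_right fun h => (Prod.mk.inj h).2))
      (fun i => hc.progress i (hinv' i).choose_spec.choose_spec.2.2)
    refine (G.good t ht).congr fun k => ?_
    rw [hfr fun s => (G.label s).1.prio (fun X => f X + (!pol).toNat) (M + (!pol).toNat) = k]
    simp only [hprio]

/-- The automaton accepts exactly the encodings of the trace assignments that satisfy `ψ`. -/
theorem mem_language_formulaAPA_iff (hc : Encodes Δ tra w c)
    (hφ : ∀ k, Admissible Δ φ ((φ k).unfold B)) (hψ : ∃ k, φ k = ψ)
    (hwf : ψ.WellFormed tra B f M) (hcl : ψ.freeVars = ∅) :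
    w ∈ (formulaAPA D φ B f M ψ).language ↔ ψ.Sat tra := by
  have hdef : StepsDefined Δ tra (c 0) := by
    rw [hc.zero]
    exact fun k hk => absurd hk (Nat.not_lt_zero k)
  constructor
  · intro hw
    by_contra hsat
    -- The variable assignment becomes the full one under complementation; as `ψ` is closed, no
    -- exits arise from it.
    have hdual : (fun _ => 0) ∈ ψ.dual.sem tra fun _ => ∅ᶜ := by
      rw [hwf.sem_dual]
      simp only [compl_compl]
      exact hsat
    obtain ⟨G⟩ := hwf.dual.nonempty_strategy (by rw [freeVars_dual, hcl]) hdual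
    obtain ⟨p, hp, hp', hgood⟩ := APA.exists_good_path_of_mem_language
      (𝒜 := formulaAPA D φ B f M ψ) (Γ := Option G.Node)
      (Inv := PlayInv (pol := false) G Δ φ c) (Rel := PlayStep (pol := false) G c) hw
      (by
        rintro _ ⟨k, rfl, rfl⟩
        refine ⟨some G.root, k, true, rfl, ?_, hdef⟩
        rw [G.label_root, hc.zero]
        rfl)
      (fun i q o h => forces_autTrans (pol := false) G hc hφ h)
    exact hgood.not_succ (parityGood_play (pol := false) G hc p hp hp')
  · intro hsat
    obtain ⟨G⟩ := hwf.nonempty_strategy hcl hsat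
    obtain ⟨k, rfl⟩ := hψ
    refine APA.mem_language_of_strategy (q₀ := .inr (k, true)) (γ₀ := some G.root)
      (Inv := PlayInv (pol := true) G Δ φ c) (Rel := PlayStep (pol := true) G c)
      ⟨k, rfl, rfl⟩ ⟨k, true, rfl, ?_, hdef⟩
      (fun i q o h => forces_autTrans (pol := true) G hc hφ h)
      (fun p hp hp' => parityGood_play (pol := true) G hc p hp hp')
    rw [G.label_root, hc.zero]
    rfl

end Automaton

end Mumbling
namespace Mumbling

/-! ### Well-aligned encodings as block words -/

section Encoding

universe u v
variable {N : Type u} {AP : Type v} {D : Finset N}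

/-- The position at which the `j`-th block starts. -/
def blockStart (b : ℕ → List (Letter D AP)) (j : ℕ) : ℕ := ((List.range j).flatMap b).length

theorem blockStart_succ (b : ℕ → List (Letter D AP)) (j : ℕ) :
    blockStart b (j + 1) = blockStart b j + (b j).length := by
  simp [blockStart, List.range_succ]

variable {b : ℕ → List (Letter D AP)}

theorem blockStart_strictMono (hb : ∀ j, b j ≠ []) : StrictMono (blockStart b) :=
  strictMono_nat_of_lt_succ fun j => by
    have := List.length_pos_of_ne_nil (hb j)
    rw [blockStart_succ]
    omega

theorem concat_blockStart_add (hb : ∀ j, b j ≠ []) {j m : ℕ} (hm : m < (b j).length) :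
    concat b (blockStart b j + m) = (b j)[m] := by
  have key : ∀ J, j < J → ((List.range J).flatMap b).getD (blockStart b j + m) .top = (b j)[m] := by
    intro J hJ
    induction J, hJ using Nat.le_induction with
    | base =>
      rw [List.range_succ, List.flatMap_append, List.getD_append_right _ _ _ _ (by simp [blockStart])]
      simp [blockStart, hm]
    | succ J hJ ih =>
      rw [List.range_succ, List.flatMap_append, List.getD_append, ih]
      change _ < blockStart b J
      have := (blockStart_strictMono hb).monotone hJ
      rw [blockStart_succ] at this
      omega
  -- At position `i`, `concat` inspects the first `i + 1` blocks; the block `j` is among them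
  -- because `j ≤ blockStart b j`.
  refine key _ ?_
  have := (blockStart_strictMono hb).le_apply (x := j)
  omega

theorem exists_eq_blockStart_add (hb : ∀ j, b j ≠ []) (i : ℕ) :
    ∃ j m, m < (b j).length ∧ i = blockStart b j + m := by
  induction i with
  | zero => exact ⟨0, 0, List.length_pos_of_ne_nil (hb 0), rfl⟩
  | succ i ih =>
    obtain ⟨j, m, hm, rfl⟩ := ih
    by_cases h : m + 1 < (b j).length
    · exact ⟨j, m + 1, h, rfl⟩
    · refine ⟨j + 1, 0, List.length_pos_of_ne_nil (hb _), ?_⟩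
      rw [blockStart_succ]
      omega

/-- There is a function that counts the blocks that start before a position. -/
theorem exists_blockCount (hb : ∀ j, b j ≠ []) : ∃ c : ℕ → ℕ, (∀ j, c (blockStart b j) = j) ∧
    (∀ i, i ≤ blockStart b (c i)) ∧
    ∀ j m, m < (b j).length → c (blockStart b j + m + 1) = j + 1 := by
  classical
  have hmono := blockStart_strictMono hb
  have hex : ∀ i, ∃ j, i ≤ blockStart b j := fun i => ⟨i, hmono.le_apply⟩
  refine ⟨fun i => Nat.find (hex i), fun j => ?_, fun i => Nat.find_spec (hex i), fun j m hm => ?_⟩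
  · rw [Nat.find_eq_iff]
    exact ⟨le_rfl, fun k hk => not_le.2 (hmono hk)⟩
  · rw [Nat.find_eq_iff]
    refine ⟨?_, fun k hk => ?_⟩
    · rw [blockStart_succ]
      omega
    · have := hmono.monotone (Nat.lt_succ_iff.1 hk)
      omega

variable {Δ : N → TraceFormula AP} {tra : D → Trace AP}

theorem StepsDefined.mono {i j : ℕ} (h : StepsDefined Δ tra j) (hij : i ≤ j) :
    StepsDefined Δ tra i :=
  fun k hk => h k (hk.trans_le hij)

/-- Let `c` count the blocks already begun: it is `j` at the first letter of block `j` and `j + 1`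
at the later ones. Longer blocks occur only if step `j` is defined, so every `call` or `ret` is read
while `StepsDefined` still holds for the current count, and it fails right after the last tuple. -/
theorem exists_encodes_concat
    (h₁ : ∀ j, StepsDefined Δ tra (j + 1) → ∃ rc, b j = blockWord (labels Δ tra j) rc)
    (h₂ : ∀ j, StepsDefined Δ tra j → ¬ StepsDefined Δ tra (j + 1) →
      b j = [.props (labels Δ tra j)])
    (h₃ : ∀ j, ¬ StepsDefined Δ tra j → b j = [.top]) :
    ∃ c, Encodes Δ tra (concat b) c := by
  have hhead : ∀ j, StepsDefined Δ tra j → ∃ l, b j = .props (labels Δ tra j) :: l := by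
    intro j hj
    by_cases hj' : StepsDefined Δ tra (j + 1)
    · obtain ⟨rc, h⟩ := h₁ j hj'
      exact ⟨_, h⟩
    · exact ⟨_, h₂ j hj hj'⟩
  have hsingle : ∀ j, ¬ StepsDefined Δ tra (j + 1) → (b j).length = 1 := by
    intro j hj'
    by_cases hj : StepsDefined Δ tra j
    · rw [h₂ j hj hj']
      rfl
    · rw [h₃ j hj]
      rfl
  have hb : ∀ j, b j ≠ [] := by
    intro j
    by_cases hj : StepsDefined Δ tra j
    · obtain ⟨l, hl⟩ := hhead j hj
      simp [hl]
    · simp [h₃ j hj]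
  obtain ⟨c, hstart, hle, hsucc⟩ := exists_blockCount hb
  refine ⟨c, hstart 0, fun i hi => ?_, fun i hi => ?_, fun i _ => ⟨_, hle i, ?_⟩⟩
  · obtain ⟨j, m, hm, rfl⟩ := exists_eq_blockStart_add hb i
    rw [concat_blockStart_add hb hm, hsucc j m hm]
    cases m with
    | zero =>
      rw [add_zero, hstart] at hi ⊢
      obtain ⟨l, hl⟩ := hhead j hi
      simp [hl]
    | succ m =>
      have hcm := hsucc j m (by omega)
      rw [add_assoc] at hcm
      rw [hcm] at hi ⊢
      obtain ⟨rc, hrc⟩ := h₁ j hi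
      refine .inr ⟨?_, rfl⟩
      have hmem : (b j)[m + 1] ∈ List.replicate rc.1 Letter.ret ++ List.replicate rc.2 .call := by
        simp only [hrc, blockWord, List.getElem_cons_succ]
        exact List.getElem_mem _
      rw [List.mem_append, List.mem_replicate, List.mem_replicate] at hmem
      exact hmem.symm.imp And.right And.right
  · obtain ⟨j, m, hm, rfl⟩ := exists_eq_blockStart_add hb i
    rw [concat_blockStart_add hb hm]
    cases m with
    | zero =>
      rw [add_zero, hstart] at hi
      simp [h₃ j hi]
    | succ m =>
      have hcm := hsucc j m (by omega)
      rw [add_assoc] at hcm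
      rw [hcm] at hi
      have := hsingle j hi
      omega
  · rw [hstart]
    exact hsucc _ 0 (List.length_pos_of_ne_nil (hb _))

/-! ### The well-aligned prefix and the two kinds of encodings -/

theorem isSome_progW {j : ℕ} : (progW Δ tra j).isSome ↔ StepsDefined Δ tra j := by
  have key : ∀ j, (StepsDefined Δ tra j → progW Δ tra j = some (prog Δ tra j)) ∧
      (¬ StepsDefined Δ tra j → progW Δ tra j = none) := by
    intro j
    induction j with
    | zero => exact ⟨fun _ => rfl, fun h => absurd (fun k hk => absurd hk (Nat.not_lt_zero k)) h⟩
    | succ j ih =>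
      rw [stepsDefined_succ, progW]
      constructor
      · intro h
        rw [ih.1 h.1, Option.bind_some, succW_eq_some, prog_succ]
        exact ⟨h.2, rfl⟩
      · intro h
        by_cases hj : StepsDefined Δ tra j
        · rw [ih.1 hj, Option.bind_some, succW_eq_none]
          exact fun h' => h ⟨hj, h'⟩
        · rw [ih.2 hj, Option.bind_none]
  by_cases h : StepsDefined Δ tra j
  · simp [(key j).1 h, h]
  · simp [(key j).2 h, h]

/-- The numbers of possible steps are closed downwards, so lying strictly below their supremum means
that one more step is possible. -/
theorem coe_lt_wapref {j : ℕ} : (j : ℕ∞) < wapref Δ tra ↔ StepsDefined Δ tra (j + 1) := by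
  simp only [wapref, lt_sSup_iff, isSome_progW]
  constructor
  · rintro ⟨_, ⟨i, hi, rfl⟩, hji⟩
    exact hi.mono (Nat.cast_lt.1 hji)
  · intro h
    exact ⟨_, ⟨j + 1, h, rfl⟩, Nat.cast_lt.2 (Nat.lt_succ_self j)⟩

theorem coe_eq_wapref {j : ℕ} (h : ¬ StepsDefined Δ tra (j + 1)) :
    (j : ℕ∞) = wapref Δ tra ↔ StepsDefined Δ tra j := by
  rw [← coe_lt_wapref, not_lt] at h
  constructor
  · intro hj
    cases j with
    | zero => exact fun k hk => absurd hk (Nat.not_lt_zero k)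
    | succ j =>
      rw [← coe_lt_wapref, ← hj]
      exact Nat.cast_lt.2 (Nat.lt_succ_self j)
  · intro hj
    exact le_antisymm (le_sSup ⟨j, isSome_progW.2 hj, rfl⟩) h

theorem exists_encodes_encoding (Δ : N → TraceFormula AP) (tra : D → Trace AP) (π : D) :
    ∃ c, Encodes Δ tra (encoding Δ tra π) c := by
  refine exists_encodes_concat (fun j h => ?_) (fun j h h' => ?_) (fun j h => ?_)
  · exact ⟨_, if_pos (coe_lt_wapref.2 h)⟩
  · rw [if_neg (fun h => h' (coe_lt_wapref.1 h)), if_pos ((coe_eq_wapref h').2 h)]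
  · have h' : ¬ StepsDefined Δ tra (j + 1) := fun h' => h (h'.mono (Nat.le_succ j))
    rw [if_neg (fun h => h' (coe_lt_wapref.1 h)), if_neg (fun h'' => h ((coe_eq_wapref h').1 h''))]

/-- Without traces well-alignment is vacuous, so all steps are defined and `⊤` never occurs. The
profiles may be arbitrary, because `Encodes` does not prescribe how many symbols separate two
tuples. -/
theorem IsEmptyEncoding.exists_encodes {w : ℕ → Letter D AP} (hw : IsEmptyEncoding w)
    (hD : D = ∅) (Δ : N → TraceFormula AP) (tra : D → Trace AP) : ∃ c, Encodes Δ tra w c := by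
  subst hD
  obtain ⟨rc, rfl⟩ := hw
  have hdef : ∀ j, StepsDefined Δ tra j := fun j k _ π => absurd π.2 (Finset.notMem_empty _)
  refine exists_encodes_concat (fun j _ => ⟨rc j, ?_⟩) (fun j _ h' => absurd (hdef _) h')
    (fun j h => absurd (hdef _) h)
  congr 1
  funext π
  exact absurd π.2 (Finset.notMem_empty _)

end Encoding

/-! ### Binders, priorities and size -/

section Size

universe u v
variable {N : Type u} {AP : Type v} {D : Finset N}

namespace Formula

theorem mem_subformulae_self (ψ : Formula N AP) : ψ ∈ ψ.subformulae := by
  cases ψ <;> simp [subformulae]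

theorem subformulae_subset {χ ψ : Formula N AP} (h : χ ∈ ψ.subformulae) :
    χ.subformulae ⊆ ψ.subformulae := by
  induction ψ with
  | test | var =>
    rw [Set.mem_singleton_iff.1 h]
  | neg _ ih | nextW _ _ ih | nextD _ _ ih | mu _ _ ih | nu _ _ ih =>
    rcases h with rfl | h
    · rfl
    · exact (ih h).trans (Set.subset_insert _ _)
  | or _ _ ih₁ ih₂ | and _ _ ih₁ ih₂ =>
    rcases h with rfl | h | h
    · rfl
    · exact (ih₁ h).trans (Set.subset_union_left.trans (Set.subset_insert _ _))
    · exact (ih₂ h).trans (Set.subset_union_right.trans (Set.subset_insert _ _))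

theorem sizeOf_le_of_mem_subformulae {χ ψ : Formula N AP} (h : χ ∈ ψ.subformulae) :
    sizeOf χ ≤ sizeOf ψ := by
  induction ψ with
  | test | var => rw [Set.mem_singleton_iff.1 h]
  | neg _ ih | nextW _ _ ih | nextD _ _ ih | mu _ _ ih | nu _ _ ih =>
    rcases h with rfl | h
    · rfl
    · have := ih h
      simp
      omega
  | or _ _ ih₁ ih₂ | and _ _ ih₁ ih₂ =>
    rcases h with rfl | h | h
    · rfl
    · have := ih₁ h
      simp
      omega
    · have := ih₂ h
      simp
      omega

theorem size_mono {χ ψ : Formula N AP} (h : χ ∈ ψ.subformulae) : χ.size ≤ ψ.size :=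
  Set.ncard_le_ncard (subformulae_subset h) ψ.subformulae_finite

/-- A formula is not a subformula of its immediate operand, so the operand has strictly fewer
subformulae. This makes the sizes of binders order priorities by nesting. -/
theorem size_lt {χ ξ ψ : Formula N AP} (hχ : χ ∈ ξ.subformulae)
    (hψ : ψ.subformulae = insert ψ ξ.subformulae) (hs : sizeOf ξ < sizeOf ψ) :
    χ.size < ψ.size := by
  refine (size_mono hχ).trans_lt (Set.ncard_lt_ncard ?_ ψ.subformulae_finite)
  rw [hψ]
  exact Set.ssubset_insert fun h => absurd (sizeOf_le_of_mem_subformulae h) (not_le.2 hs)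

theorem exists_binds_of_mem_boundVars {ψ : Formula N AP} {X : ℕ} (h : X ∈ ψ.boundVars) :
    ∃ χ ∈ ψ.subformulae, χ.Binds X := by
  induction ψ with
  | test | var | neg => exact h.elim
  | nextW _ _ ih | nextD _ _ ih =>
    obtain ⟨χ, hχ, hX⟩ := ih h
    exact ⟨χ, .inr hχ, hX⟩
  | or _ _ ih₁ ih₂ | and _ _ ih₁ ih₂ =>
    rcases h with h | h
    · obtain ⟨χ, hχ, hX⟩ := ih₁ h
      exact ⟨χ, .inr (.inl hχ), hX⟩
    · obtain ⟨χ, hχ, hX⟩ := ih₂ h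
      exact ⟨χ, .inr (.inr hχ), hX⟩
  | mu _ ψ ih =>
    rcases h with rfl | h
    · exact ⟨_, .inl rfl, ψ, .inl rfl⟩
    · obtain ⟨χ, hχ, hX⟩ := ih h
      exact ⟨χ, .inr hχ, hX⟩
  | nu _ ψ ih =>
    rcases h with rfl | h
    · exact ⟨_, .inl rfl, ψ, .inr rfl⟩
    · obtain ⟨χ, hχ, hX⟩ := ih h
      exact ⟨χ, .inr hχ, hX⟩

open Classical in
/-- The fixpoint subformula of `ψ` that binds `X`. -/
noncomputable def binder (ψ : Formula N AP) (X : ℕ) : Formula N AP :=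
  if h : ∃ χ ∈ ψ.subformulae, χ.Binds X then h.choose else var X

/-- The body of a fixpoint formula. -/
def body : Formula N AP → Formula N AP
  | mu _ ψ => ψ
  | nu _ ψ => ψ
  | ψ => ψ

/-- `1` for least fixpoints and `0` for other formulae. -/
def parity : Formula N AP → ℕ
  | mu _ _ => 1
  | _ => 0

/-- The priority of a fixpoint variable: outer fixpoints have smaller priorities. -/
noncomputable def varPrio (ψ : Formula N AP) (X : ℕ) : ℕ :=
  2 * (ψ.size - (ψ.binder X).size) + (ψ.binder X).parity

theorem binder_eq {ψ χ : Formula N AP} (h : ψ.UniquelyBound) (hχ : χ ∈ ψ.subformulae) {X : ℕ}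
    (hX : χ.Binds X) : ψ.binder X = χ := by
  have hex : ∃ χ ∈ ψ.subformulae, χ.Binds X := ⟨χ, hχ, hX⟩
  rw [binder, dif_pos hex]
  exact h X _ hex.choose_spec.1 _ hχ hex.choose_spec.2 hX

theorem parity_le (ψ : Formula N AP) : ψ.parity ≤ 1 := by
  cases ψ <;> simp [parity]

theorem varPrio_le (ψ : Formula N AP) (X : ℕ) : ψ.varPrio X ≤ 2 * ψ.size + 2 := by
  have := (ψ.binder X).parity_le
  unfold varPrio
  omega

theorem prio_le (ψ χ : Formula N AP) :
    χ.prio ψ.varPrio (2 * ψ.size + 2) ≤ 2 * ψ.size + 2 := by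
  cases χ with
  | var X => exact ψ.varPrio_le X
  | _ => exact le_rfl

/-- An inner binder has strictly smaller size, which raises the even part of its priority by at
least two and outweighs the parity bit of the outer one. -/
theorem varPrio_le_varPrio {ψ χ ξ : Formula N AP} (h : ψ.UniquelyBound) (hχ : χ ∈ ψ.subformulae)
    {X Y : ℕ} (hX : χ.Binds X) (hξ : χ.subformulae = insert χ ξ.subformulae)
    (hs : sizeOf ξ < sizeOf χ) (hY : Y ∈ ξ.boundVars) : ψ.varPrio X ≤ ψ.varPrio Y := by
  obtain ⟨β, hβ, hβY⟩ := exists_binds_of_mem_boundVars hY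
  have hβχ : β ∈ χ.subformulae := by
    rw [hξ]
    exact .inr hβ
  rw [varPrio, varPrio, binder_eq h hχ hX, binder_eq h (subformulae_subset hχ hβχ) hβY]
  have h1 := size_lt hβ hξ hs
  have h2 := size_mono hχ
  have h3 := χ.parity_le
  omega

/-- Unique binding ensures that `binder` returns the very fixpoint formula under consideration, so
its body and the parity of its priority are the right ones. -/
theorem wellFormed_of_subset {ψ : Formula N AP} (hpos : ψ.PositiveForm) (hub : ψ.UniquelyBound)
    (tra : D → Trace AP) {χ : Formula N AP} (hχ : χ.subformulae ⊆ ψ.subformulae)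
    (hg : χ.StrictlyGuarded) :
    χ.WellFormed tra (fun X => (ψ.binder X).body) ψ.varPrio (2 * ψ.size + 2) := by
  induction χ with
  | test => trivial
  | var => exact hg
  | neg χ =>
    obtain ⟨δ, π, rfl⟩ := hpos χ (hχ (mem_subformulae_self _))
    exact fun _ _ => rfl
  | or _ _ ih₁ ih₂ | and _ _ ih₁ ih₂ =>
    exact ⟨ih₁ (fun _ h => hχ (.inr (.inl h))) hg.1, ih₂ (fun _ h => hχ (.inr (.inr h))) hg.2⟩
  | nextW _ _ ih | nextD _ _ ih => exact hg.imp_right (ih fun _ h => hχ (.inr h))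
  | mu X χ ih =>
    have hmem := hχ (mem_subformulae_self _)
    have hX : (mu X χ).Binds X := ⟨χ, .inl rfl⟩
    have hb := binder_eq hub hmem hX
    refine ⟨by simp only [hb, body], ?_, varPrio_le _ _,
      fun Y hY => varPrio_le_varPrio hub hmem hX rfl (by simp) hY,
      ih (fun _ h => hχ (.inr h)) hg⟩
    rw [varPrio, hb]
    exact odd_two_mul_add_one _
  | nu X χ ih =>
    have hmem := hχ (mem_subformulae_self _)
    have hX : (nu X χ).Binds X := ⟨χ, .inr rfl⟩
    have hb := binder_eq hub hmem hX
    refine ⟨by simp only [hb, body], ?_, varPrio_le _ _,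
      fun Y hY => varPrio_le_varPrio hub hmem hX rfl (by simp) hY,
      ih (fun _ h => hχ (.inr h)) hg⟩
    rw [varPrio, hb]
    exact even_two_mul _

end Formula

/-! ### Admissibility of the transition formulae and size of the automaton -/

open Formula

variable {n : ℕ} {φ : Fin n → Formula N AP} {ψ : Formula N AP} {Δ : N → TraceFormula AP}

theorem admissible_of_mem (hpos : ψ.PositiveForm) (hΔ : ψ.HasUniqueAssignment Δ)
    (hat : ψ.HasAtomicBasis) (hφ : ∀ χ ∈ ψ.subformulae, ∃ k, φ k = χ) {χ : Formula N AP}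
    (hχ : χ.subformulae ⊆ ψ.subformulae) : Admissible Δ φ χ := by
  induction χ with
  | test δ π => exact hat δ (.inl ⟨π, hχ (mem_subformulae_self _)⟩)
  | var => trivial
  | neg χ ih =>
    obtain ⟨δ, π, rfl⟩ := hpos χ (hχ (mem_subformulae_self _))
    obtain ⟨p, rfl⟩ := ih fun _ h => hχ (.inr h)
    exact ⟨p, π, rfl⟩
  | or _ _ ih₁ ih₂ | and _ _ ih₁ ih₂ =>
    exact ⟨ih₁ fun _ h => hχ (.inr (.inl h)), ih₂ fun _ h => hχ (.inr (.inr h))⟩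
  | nextW Δ' χ ih =>
    exact ⟨hΔ Δ' ⟨χ, .inl (hχ (mem_subformulae_self _))⟩,
      hφ χ (hχ (.inr (mem_subformulae_self _)))⟩
  | nextD Δ' χ ih =>
    exact ⟨hΔ Δ' ⟨χ, .inr (hχ (mem_subformulae_self _))⟩,
      hφ χ (hχ (.inr (mem_subformulae_self _)))⟩
  | mu _ _ ih | nu _ _ ih => exact ih fun _ h => hχ (.inr h)

/-- The body of a binder is again a subformula, so unfolding adds no formulae to be evaluated. Only
a variable without a binder in `ψ` remains unchanged. -/
theorem unfold_mem_or {χ : Formula N AP} (hχ : χ ∈ ψ.subformulae) :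
    χ.unfold (fun X => (ψ.binder X).body) ∈ ψ.subformulae ∨
      ∃ X, χ.unfold (fun X => (ψ.binder X).body) = var X := by
  cases χ with
  | var X =>
    simp only [unfold]
    by_cases hex : ∃ χ ∈ ψ.subformulae, χ.Binds X
    · left
      rw [binder, dif_pos hex]
      obtain ⟨hmem, ξ, h | h⟩ := hex.choose_spec <;>
      · rw [h] at hmem ⊢
        exact subformulae_subset hmem (.inr (mem_subformulae_self ξ))
    · right
      rw [binder, dif_neg hex]
      exact ⟨X, rfl⟩
  | _ => exact .inl hχ

/-- Evaluation follows the syntax tree: boolean connectives are kept, fixpoint operators are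
skipped, and everything else becomes an atom. Sharing of subformulae in `ψ` is thus preserved. -/
theorem subformulae_evalFormula (P : D → Set AP) (χ : Formula N AP) :
    (evalFormula φ P χ).subformulae ⊆ evalFormula φ P '' χ.subformulae := by
  induction χ with
  | test | var | neg | nextW | nextD =>
    rintro _ rfl
    exact ⟨_, mem_subformulae_self _, rfl⟩
  | or _ _ ih₁ ih₂ | and _ _ ih₁ ih₂ =>
    rintro F (rfl | h | h)
    · exact ⟨_, mem_subformulae_self _, rfl⟩
    · exact Set.image_mono (fun _ h => .inr (.inl h)) (ih₁ h)
    · exact Set.image_mono (fun _ h => .inr (.inr h)) (ih₂ h)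
  | mu _ _ ih | nu _ _ ih => exact ih.trans (Set.image_mono (Set.subset_insert _ _))

theorem transSubformulae_formulaAPA (hφ : ∀ k, φ k ∈ ψ.subformulae) (f : ℕ → ℕ) (M : ℕ)
    (a : Letter D AP) :
    ∃ g : Formula N AP → PosBool (AutState n),
      (formulaAPA D φ (fun X => (ψ.binder X).body) f M ψ).transSubformulae a ⊆
        g '' ψ.subformulae ∪ Set.range PosBool.atom := by
  have hatom : ∀ (q : AutState n) (X : Set (PosBool (AutState n))),
      (PosBool.atom q).subformulae ⊆ X ∪ Set.range PosBool.atom := by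
    rintro q X _ rfl
    exact .inr ⟨q, rfl⟩
  cases a with
  | props P =>
    refine ⟨evalFormula φ P, Set.iUnion_subset ?_⟩
    rintro (b | ⟨k, b⟩)
    · exact hatom _ _
    · rcases unfold_mem_or (hφ k) with h | ⟨X, h⟩
      · exact (subformulae_evalFormula P _).trans
          ((Set.image_mono (subformulae_subset h)).trans Set.subset_union_left)
      · change (evalFormula φ P _).subformulae ⊆ _
        rw [h]
        exact hatom _ _
  | call | ret | top =>
    refine ⟨fun _ => .atom (.inl true), Set.iUnion_subset ?_⟩
    rintro (b | ⟨k, b⟩) <;> exact hatom _ _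

theorem size_formulaAPA_le {φ : Fin ψ.size → Formula N AP} (hφ : ∀ k, φ k ∈ ψ.subformulae) :
    (formulaAPA D φ (fun X => (ψ.binder X).body) ψ.varPrio (2 * ψ.size + 2) ψ).size ≤
      ((13 * ψ.size : ℕ) : ℕ∞) := by
  have hcard : ENat.card (AutState ψ.size) = ((2 + ψ.size * 2 : ℕ) : ℕ∞) := by
    rw [ENat.card_eq_coe_fintype_card]
    simp
  have hpos : 0 < ψ.size :=
    (Set.ncard_pos ψ.subformulae_finite).2 ⟨ψ, mem_subformulae_self ψ⟩
  have hprio : (⨆ q : AutState ψ.size, (autPrio φ ψ.varPrio (2 * ψ.size + 2) q : ℕ∞)) ≤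
      ((2 * ψ.size + 2 : ℕ) : ℕ∞) := by
    refine iSup_le ?_
    rintro (b | ⟨k, b⟩) <;> refine Nat.cast_le.2 ?_
    · exact (Bool.toNat_le _).trans (by omega)
    · exact prio_le ψ _
  have htrans : (⨆ a, ((formulaAPA D φ (fun X => (ψ.binder X).body) ψ.varPrio
      (2 * ψ.size + 2) ψ).transSubformulae a).encard) ≤
      ((ψ.size + (2 + ψ.size * 2) : ℕ) : ℕ∞) := by
    refine iSup_le fun a => ?_
    obtain ⟨g, hg⟩ := transSubformulae_formulaAPA hφ ψ.varPrio (2 * ψ.size + 2) a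
    refine (Set.encard_le_encard hg).trans ((Set.encard_union_le _ _).trans ?_)
    rw [Nat.cast_add, ← hcard]
    refine add_le_add ?_ ?_
    · refine (Set.encard_image_le _ _).trans ?_
      rw [size, ψ.subformulae_finite.cast_ncard_eq]
    · rw [← Set.image_univ, ← Set.encard_univ]
      exact Set.encard_image_le _ _
  -- With `s = ψ.size`, the states, priorities and transition subformulae contribute `2 + 2s`, `2s +
  -- 2` and `s + (2 + 2s)`; their sum `7s + 6` is at most `13s` because `s ≥ 1`.
  refine (add_le_add (add_le_add hcard.le hprio) htrans).trans ?_
  rw [← Nat.cast_add, ← Nat.cast_add, Nat.cast_le]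
  omega

end Size

end Mumbling

/-! ### Assembly of the theorem -/

theorem mainTheorem10 :
    ∃ C : ℕ, ∀ (N AP : Type*) [Finite AP] (ψ : Mumbling.Formula N AP)
      (Δ : N → Mumbling.TraceFormula AP) (D : Finset N),
      ψ.Closed → ψ.PositiveForm → ψ.StrictlyGuarded → ψ.UniquelyBound →
      ψ.HasUniqueAssignment Δ → ψ.HasAtomicBasis → ψ.traceVars ⊆ ↑D →
      ∃ 𝒜 : Mumbling.APA (Mumbling.Letter D AP),
        𝒜.size ≤ ((C * ψ.size : ℕ) : ℕ∞) ∧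
        ∀ 𝒯 : Set (Mumbling.Trace AP), Mumbling.AlignedEquivalent D Δ 𝒯 ψ 𝒜 := by
  refine ⟨13, fun N AP _ ψ Δ D hcl hpos hg hub hΔ hat _ => ?_⟩
  have := ψ.subformulae_finite.to_subtype
  let e : ψ.subformulae ≃ Fin ψ.size := Finite.equivFinOfCardEq rfl
  let φ : Fin ψ.size → Mumbling.Formula N AP := fun k => e.symm k
  have hφ : ∀ χ ∈ ψ.subformulae, ∃ k, φ k = χ := fun χ hχ => ⟨e ⟨χ, hχ⟩, by simp [φ]⟩
  have hmem : ∀ k, φ k ∈ ψ.subformulae := fun k => (e.symm k).2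
  refine ⟨_, Mumbling.size_formulaAPA_le (D := D) hmem, fun 𝒯 tra _ => ?_⟩
  have hadm : ∀ k, Mumbling.Admissible Δ φ ((φ k).unfold fun X => (ψ.binder X).body) := by
    intro k
    rcases Mumbling.unfold_mem_or (hmem k) with h | ⟨X, h⟩
    · exact Mumbling.admissible_of_mem hpos hΔ hat hφ (Mumbling.Formula.subformulae_subset h)
    · rw [h]
      trivial
  have hwf := Mumbling.Formula.wellFormed_of_subset hpos hub tra subset_rfl hg
  -- Acceptance is the same for all encodings of `tra`, which settles the existential statement for
  -- the empty domain as well.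
  have key : ∀ w, (∃ c, Mumbling.Encodes Δ tra w c) → (ψ.Sat tra ↔ w ∈ _) :=
    fun w ⟨c, hc⟩ => (Mumbling.mem_language_formulaAPA_iff hc hadm
      (hφ ψ ψ.mem_subformulae_self) hwf hcl.1).symm
  refine ⟨fun π => key _ (Mumbling.exists_encodes_encoding Δ tra π), fun hD => ?_⟩
  constructor
  · intro h
    -- Any encoding would do; this one consists of empty tuples only.
    have hw : Mumbling.IsEmptyEncoding (D := D) (AP := AP) _ := ⟨fun _ => (0, 0), rfl⟩
    exact ⟨_, hw, (key _ (hw.exists_encodes hD Δ tra)).1 h⟩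
  · rintro ⟨w, hw, h⟩
    exact (key w (hw.exists_encodes hD Δ tra)).2 h
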